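/- Let $q$ be a real number with $0<|q|<1$ and let $d\ge 1$ and $j,k\ge 0$ be integers. For $N\ge\max(j,k)$ write $(N^d,j)$ for the partition with $d$ parts equal to $N$ followed by one part equal to $j$, and let $$s_{(N^d,j)/(k)}(1,q,q^2,\dots)=\sum_T\prod_{c}q^{T(c)}$$ be the principal specialization of the skew Schur function in infinitely many variables, where $T$ runs over the semistandard tableaux of skew shape $(N^d,j)/(k)$ with entries in $\{0,1,2,\dots\}$ and $c$ over the cells of the shape. For integers $n\ge 0$ put $(q;q)_n=\prod_{i=1}^n(1-q^i)$, $(q;q)_\infty=\prod_{i=1}^\infty(1-q^i)$, $\Gamma_q(n+1)=(q;q)_n/(1-q)^n$, $G_q(n+1)=\prod_{i=1}^{n-1}\Gamma_q(i+1)$ (empty products are $1$), and for $0\le m\le n$ put $\binom{n}{m}_q=\frac{\Gamma_q(n+1)}{\Gamma_q(m+1)\Gamma_q(n-m+1)}$. (a) For every $N\ge\max(j,k)$ the sum defining $s_{(N^d,j)/(k)}(1,q,q^2,\dots)$ converges absolutely, and $$s_{(N^d,j)/(k)}(1,q,q^2,\dots)=\frac{q^{(d-1)j-dk+d(d-1)N/2}}{(1-q)^{d(N+1)}}\,\frac{G_q(N+2)\,G_q(d+1)}{G_q(d+N+2)}\,\frac{(q;q)_{d+k}}{(q;q)_j}\sum_{r=\max(j,k)}^{N}q^r\binom{r}{r-k}_q\binom{d+r-j-1}{r-j}_q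 .$$ (b) Put $$A_N=q^{dj-(d-1)k+d(d-1)N/2}\,\frac{(1-q)^{d(d-1)/2}\,G_q(d+1)}{(q;q)_\infty^{d}},\qquad S=\sum_{r=0}^{\min(j,k)}q^{-r}\frac{1}{(q;q)_{j-r}}\binom{d+k-r-1}{k-r}_q .$$ With $d,j,k,q$ fixed and $N\to\infty$ we have $s_{(N^d,j)/(k)}(1,q,q^2,\dots)/A_N\to S$. In particular, if $0<q<1$, then $s_{(N^d,j)/(k)}(1,q,q^2,\dots)\sim A_N\,S$, that is, the quotient of the two sides tends to $1$. -/

import Mathlib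

open Filter Topology Asymptotics

noncomputable section

/-- A semistandard tableau of skew shape `lam / mu`, with entries in `ℕ`: a filling of the cells of
`lam` that are not in `mu`, weakly increasing along rows and strictly increasing down columns.
As for Mathlib's `SemistandardYoungTableau`, the filling is a function `ℕ → ℕ → ℕ` that vanishes
off the shape.  There is no such tableau unless `mu` is contained in `lam`. -/
@[ext]
structure SkewTableau (lam mu : YoungDiagram) where
  entry : ℕ → ℕ → ℕ
  contained : mu ≤ lam
  row_weak : ∀ {i c₁ c₂ : ℕ}, c₁ < c₂ → (i, c₁) ∉ mu → (i, c₂) ∈ lam →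
    entry i c₁ ≤ entry i c₂
  col_strict : ∀ {i₁ i₂ c : ℕ}, i₁ < i₂ → (i₁, c) ∉ mu → (i₂, c) ∈ lam →
    entry i₁ c < entry i₂ c
  zeros : ∀ {i c : ℕ}, (i, c) ∉ lam ∨ (i, c) ∈ mu → entry i c = 0

/-- The monomial `x^T`: the product of the variables indexed by the entries of `T`. -/
def SkewTableau.weight {lam mu : YoungDiagram} (x : ℕ → ℝ) (T : SkewTableau lam mu) : ℝ :=
  ∏ c ∈ lam.cells \ mu.cells, x (T.entry c.1 c.2)

/-- The skew Schur function `s_{lam/mu}(x 0, x 1, x 2, …)` in infinitely many variables, evaluated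
at real numbers: the sum of `x^T` over all semistandard tableaux `T` of shape `lam / mu`. -/
def skewSchur (lam mu : YoungDiagram) (x : ℕ → ℝ) : ℝ :=
  ∑' T : SkewTableau lam mu, T.weight x

/-- The diagram of the rectangular partition `(b^a)`: `a` rows of length `b`. -/
def rectDiagram (a b : ℕ) : YoungDiagram where
  cells := Finset.range a ×ˢ Finset.range b
  isLowerSet := by
    rintro ⟨i, c⟩ ⟨i', c'⟩ ⟨h₁, h₂⟩ h
    simp only [Finset.coe_product, Finset.coe_range, Set.mem_prod, Set.mem_Iio] at h ⊢
    exact ⟨lt_of_le_of_lt h₁ h.1, lt_of_le_of_lt h₂ h.2⟩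

/-- The diagram of the partition `(N, …, N, j)` with `d` parts equal to `N` followed by a part `j`,
where `j ≤ N` (see `rowLen_rectAddRow`). -/
def rectAddRow (d N j : ℕ) : YoungDiagram :=
  rectDiagram d N ⊔ rectDiagram (d + 1) j

/-- The diagram of the one-row partition `(k)`. -/
def oneRow (k : ℕ) : YoungDiagram := rectDiagram 1 k

theorem mem_rectDiagram {a b i c : ℕ} : (i, c) ∈ rectDiagram a b ↔ i < a ∧ c < b := by
  rw [← YoungDiagram.mem_cells]
  simp [rectDiagram]

theorem rowLen_rectAddRow {d N j : ℕ} (hj : j ≤ N) (i : ℕ) :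
    (rectAddRow d N j).rowLen i = if i < d then N else if i = d then j else 0 := by
  refine eq_of_forall_lt_iff fun c => ?_
  rw [← YoungDiagram.mem_iff_lt_rowLen, rectAddRow, YoungDiagram.mem_sup, mem_rectDiagram,
    mem_rectDiagram]
  split_ifs <;> omega

theorem rowLen_oneRow (k i : ℕ) : (oneRow k).rowLen i = if i = 0 then k else 0 := by
  refine eq_of_forall_lt_iff fun c => ?_
  rw [← YoungDiagram.mem_iff_lt_rowLen, oneRow, mem_rectDiagram]
  split_ifs <;> omega

/-- `(q;q)_n = ∏_{i=1}^{n} (1 - q^i)`. -/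
def qPoch (q : ℝ) (n : ℕ) : ℝ := ∏ i ∈ Finset.Icc 1 n, (1 - q ^ i)

/-- The Euler function `(q;q)_∞ = ∏_{i=1}^{∞} (1 - q^i)`. -/
def qPochInf (q : ℝ) : ℝ := ∏' i : ℕ, (1 - q ^ (i + 1))

/-- The `q`-Gamma function at natural arguments, `Γ_q(n+1) = (q;q)_n / (1-q)^n`
(at its pole `0` it is given the value `0`; this value is never used). -/
def qGamma (q : ℝ) : ℕ → ℝ
  | 0 => 0
  | n + 1 => qPoch q n / (1 - q) ^ n

/-- The `q`-Barnes function at natural arguments: `G_q(0) = 0` and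
`G_q(n+1) = ∏_{i=1}^{n-1} Γ_q(i+1)`. -/
def qBarnes (q : ℝ) : ℕ → ℝ
  | 0 => 0
  | n + 1 => ∏ i ∈ Finset.Ico 1 n, qGamma q (i + 1)

/-- The `q`-binomial coefficient
`[n choose m]_q = Γ_q(n+1) / (Γ_q(m+1) Γ_q(n-m+1))` for `m ≤ n`, and `0` for `m > n`. -/
def qBinom (q : ℝ) (n m : ℕ) : ℝ :=
  if m ≤ n then qGamma q (n + 1) / (qGamma q (m + 1) * qGamma q (n - m + 1)) else 0

end

/-! Two independent ingredients give the exact formula. The first is the dual Jacobi–Trudi identity,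
which writes a skew Schur function as a determinant of elementary symmetric functions. In finitely
many variables both sides obey the same recursion: on tableaux, the cells containing `0` are peeled
off; on the determinant, `e_z` is split according to whether it uses `x 0`, and the rows are
expanded multilinearly (`tsum_colWeight`). The number of variables then tends to infinity. Running
the argument with |q| bounds all finite sums of absolute values, so the tableau sum converges
absolutely even for negative q (`hasSum_weight`).

The second ingredient is an explicit inverse. For the shape (N^d, j)/(k), the determinant is the
minor of the (N+1)×(N+1) Toeplitz matrix T = (e_{d+b-a}(1, q, …)) with row j and column k deleted.
By Cramer's rule it is, up to sign, det T times an entry of T⁻¹. A q-Chu–Vandermonde sum gives LT =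
U with L lower and U upper triangular, and q-binomial inversion inverts U. Hence det T is a product,
which becomes the q-Barnes quotient, and the (k, j) entry of T⁻¹ = U⁻¹L is the sum over r
(`det_elemToeplitz_minor`).

For the asymptotics, the product tends to a constant divided by (q;q)_∞^d. The sum over r becomes an
infinite series, which must be matched with a sum of only min(j,k)+1 terms. A telescoping relation
lowers j and k together by one; in the limit it is also the recursion of the short sum
(`tendsto_partialSum`). -/

noncomputable section

/-! ### q-Pochhammer symbols and q-binomial coefficients -/

theorem qPoch_zero (q : ℝ) : qPoch q 0 = 1 := by simp [qPoch]

theorem qPoch_succ (q : ℝ) (n : ℕ) : qPoch q (n + 1) = qPoch q n * (1 - q ^ (n + 1)) := by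
  rw [qPoch, Finset.prod_Icc_succ_top (by omega), ← qPoch]

theorem one_sub_pow_ne_zero {q : ℝ} (hq : |q| < 1) (n : ℕ) : 1 - q ^ (n + 1) ≠ 0 := by
  have h : |q ^ (n + 1)| < 1 := by
    rw [abs_pow]
    exact pow_lt_one₀ (abs_nonneg q) hq (by omega)
  have := (abs_lt.1 h).2
  linarith

theorem one_sub_ne_zero_of_abs_lt {q : ℝ} (hq : |q| < 1) : 1 - q ≠ 0 := by
  simpa using one_sub_pow_ne_zero hq 0

theorem qPoch_ne_zero {q : ℝ} (hq : |q| < 1) (n : ℕ) : qPoch q n ≠ 0 := by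
  induction n with
  | zero => simp [qPoch_zero]
  | succ n ih => rw [qPoch_succ]; exact mul_ne_zero ih (one_sub_pow_ne_zero hq n)

theorem qBinom_of_lt {q : ℝ} {n m : ℕ} (h : n < m) : qBinom q n m = 0 := by
  rw [qBinom, if_neg (by omega)]

theorem qBinom_add {q : ℝ} (hq : |q| < 1) (n m : ℕ) :
    qBinom q (n + m) m = qPoch q (n + m) / (qPoch q m * qPoch q n) := by
  have h1 := one_sub_ne_zero_of_abs_lt hq
  have h2 := qPoch_ne_zero hq n
  have h3 := qPoch_ne_zero hq m
  rw [qBinom, if_pos (by omega), Nat.add_sub_cancel]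
  simp only [qGamma]
  rw [pow_add]
  field_simp

theorem qBinom_zero_right {q : ℝ} (hq : |q| < 1) (n : ℕ) : qBinom q n 0 = 1 := by
  have := qPoch_ne_zero hq n
  have h := qBinom_add hq n 0
  simp only [add_zero, qPoch_zero, one_mul] at h
  rw [h, div_self this]

theorem qBinom_self {q : ℝ} (hq : |q| < 1) (n : ℕ) : qBinom q n n = 1 := by
  have := qPoch_ne_zero hq n
  have h := qBinom_add hq 0 n
  simp only [zero_add, qPoch_zero, mul_one] at h
  rw [h, div_self this]

theorem qBinom_symm_add {q : ℝ} (hq : |q| < 1) (n m : ℕ) :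
    qBinom q (n + m) n = qBinom q (n + m) m := by
  rw [qBinom_add hq n m, add_comm n m, qBinom_add hq m n, mul_comm]

/-- The `q`-Pascal rule with the power of `q` on the first summand. -/
theorem qBinom_succ_succ {q : ℝ} (hq : |q| < 1) (n m : ℕ) :
    qBinom q (n + 1) (m + 1) = q ^ (m + 1) * qBinom q n (m + 1) + qBinom q n m := by
  rcases lt_trichotomy n m with h | rfl | h
  · rw [qBinom_of_lt h, qBinom_of_lt (by omega), qBinom_of_lt (by omega)]; simp
  · rw [qBinom_self hq, qBinom_self hq, qBinom_of_lt (by omega)]; simp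
  · obtain ⟨s, rfl⟩ := Nat.exists_eq_add_of_lt h
    have e1 := qBinom_add hq (s + 1) (m + 1)
    have e2 := qBinom_add hq s (m + 1)
    have e3 := qBinom_add hq (s + 1) m
    rw [show m + s + 1 + 1 = s + 1 + (m + 1) by ring, e1,
      show m + s + 1 = s + (m + 1) by ring, e2, show s + (m + 1) = s + 1 + m by ring, e3]
    rw [show s + 1 + (m + 1) = (s + 1 + m) + 1 by ring, qPoch_succ, qPoch_succ q m,
      qPoch_succ q s]
    have h1 := qPoch_ne_zero hq s
    have h2 := qPoch_ne_zero hq m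
    have h3 := one_sub_pow_ne_zero hq s
    have h4 := one_sub_pow_ne_zero hq m
    field_simp
    ring

/-- The `q`-Pascal rule with the power of `q` on the second summand. -/
theorem qBinom_succ_succ' {q : ℝ} (hq : |q| < 1) (n m : ℕ) :
    q ^ m * qBinom q (n + 1) (m + 1) =
      q ^ m * qBinom q n (m + 1) + q ^ n * qBinom q n m := by
  rcases lt_trichotomy n m with h | rfl | h
  · rw [qBinom_of_lt h, qBinom_of_lt (by omega), qBinom_of_lt (by omega)]; simp
  · rw [qBinom_self hq, qBinom_self hq, qBinom_of_lt (by omega)]; simp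
  · obtain ⟨s, rfl⟩ := Nat.exists_eq_add_of_lt h
    have e1 := qBinom_add hq (s + 1) (m + 1)
    have e2 := qBinom_add hq s (m + 1)
    have e3 := qBinom_add hq (s + 1) m
    rw [show m + s + 1 + 1 = s + 1 + (m + 1) by ring, e1,
      show m + s + 1 = s + (m + 1) by ring, e2, show s + (m + 1) = s + 1 + m by ring, e3]
    rw [show s + 1 + (m + 1) = (s + 1 + m) + 1 by ring, qPoch_succ, qPoch_succ q m,
      qPoch_succ q s]
    have h1 := qPoch_ne_zero hq s
    have h2 := qPoch_ne_zero hq m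
    have h3 := one_sub_pow_ne_zero hq s
    have h4 := one_sub_pow_ne_zero hq m
    field_simp
    ring

/-! ### Triangular factorization of the Toeplitz matrix -/

/-- `e_z(1, q, q², …) = q^{z(z-1)/2} / (q;q)_z`, extended by `0` to negative `z`. -/
def qElem (q : ℝ) (z : ℤ) : ℝ :=
  if z < 0 then 0 else q ^ z.toNat.choose 2 / qPoch q z.toNat

theorem qElem_natCast (q : ℝ) (n : ℕ) : qElem q n = q ^ n.choose 2 / qPoch q n := by
  rw [qElem, if_neg (by omega), Int.toNat_natCast]

theorem qElem_of_neg (q : ℝ) {z : ℤ} (h : z < 0) : qElem q z = 0 := by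
  rw [qElem, if_pos h]

theorem choose_two_add (a b : ℕ) :
    (a + b).choose 2 = a.choose 2 + b.choose 2 + a * b := by
  induction b with
  | zero => simp
  | succ b ih =>
    rw [← add_assoc, Nat.choose_succ_succ' (a + b) 1, Nat.choose_succ_succ' b 1, ih]
    simp only [Nat.choose_one_right]
    ring

theorem choose_two_succ (r : ℕ) : (r + 1).choose 2 = r.choose 2 + r := by
  rw [Nat.choose_succ_succ' r 1, Nat.choose_one_right, add_comm]

theorem mul_self_eq_choose_two_add (r : ℕ) : r * r = r.choose 2 + r.choose 2 + r := by
  induction r with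
  | zero => simp
  | succ r ih =>
    rw [choose_two_succ]
    nlinarith

/-- A form of the `q`-Chu–Vandermonde summation: the triangular matrix
`(-1)^a q^{(d-1)a} [d+r-a-1 choose r-a] / (q;q)_a` brings the Toeplitz matrix of the
`e_{d+b-a}(1, q, …)` to upper triangular form. -/
theorem sum_qBinom_mul_qElem {q : ℝ} (hq0 : q ≠ 0) (hq : |q| < 1) (d b r : ℕ) :
    ∑ a ∈ Finset.range (r + 1), (-1) ^ a * ((q ^ d) ^ a / q ^ a) *
        qBinom q (d + (r - a) - 1) (r - a) / qPoch q a * qElem q ((d + b : ℕ) - a) =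
      (-1) ^ r * (q ^ ((d + b).choose 2 + r.choose 2) / q ^ (b * r)) * qBinom q b r /
        qPoch q (d + b) := by
  induction d generalizing b r with
  | zero =>
    -- For d = 0 only a = r survives: [r-a-1 choose r-a] vanishes for a < r, while truncated
    -- subtraction makes the last coefficient [0 choose 0] = 1.
    rw [Finset.sum_range_succ, Finset.sum_eq_zero, zero_add]
    · simp only [Nat.sub_self, add_zero, zero_add, pow_zero, one_pow]
      rw [show 0 - 1 = 0 from rfl, qBinom_self hq]
      rcases lt_or_ge b r with h | h
      · rw [qElem_of_neg q (by omega), qBinom_of_lt h]; simp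
      · obtain ⟨s, rfl⟩ := Nat.exists_eq_add_of_le h
        rw [show ((r + s : ℕ) : ℤ) - r = (s : ℕ) by push_cast; ring, qElem_natCast,
          add_comm r s, qBinom_add hq, choose_two_add]
        have h1 := qPoch_ne_zero hq s
        have h2 := qPoch_ne_zero hq r
        have h3 := qPoch_ne_zero hq (s + r)
        rw [add_mul, mul_self_eq_choose_two_add]
        field_simp
        ring
    · intro a ha
      have ha := Finset.mem_range.1 ha
      rw [qBinom_of_lt (by omega)]; simp
  | succ d ihd =>
    induction r with
    | zero =>
      rw [zero_add, Finset.sum_range_one]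
      simp [qBinom_zero_right hq, qPoch_zero]
      rw [show (d : ℤ) + 1 + b = ((d + 1 + b : ℕ) : ℤ) by push_cast; ring, qElem_natCast]
    | succ r ihr =>
      -- The q-Pascal rule splits each term into one of the sum for (d+1, b, r) and q^(r+1) times
      -- one of the sum for (d, b+1, r+1). The top term a = r+1 occurs only in the latter.
      have key : ∀ a ∈ Finset.range (r + 1),
          (-1) ^ a * ((q ^ (d + 1)) ^ a / q ^ a) *
            qBinom q (d + 1 + (r + 1 - a) - 1) (r + 1 - a) / qPoch q a *
              qElem q ((d + 1 + b : ℕ) - a) =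
          (-1) ^ a * ((q ^ (d + 1)) ^ a / q ^ a) *
            qBinom q (d + 1 + (r - a) - 1) (r - a) / qPoch q a *
              qElem q ((d + 1 + b : ℕ) - a) +
          q ^ (r + 1) * ((-1) ^ a * ((q ^ d) ^ a / q ^ a) *
            qBinom q (d + (r + 1 - a) - 1) (r + 1 - a) / qPoch q a *
              qElem q ((d + (b + 1) : ℕ) - a)) := by
        intro a ha
        have ha := Finset.mem_range.1 ha
        obtain ⟨s, rfl⟩ := Nat.exists_eq_add_of_le (show a ≤ r by omega)
        rw [show d + 1 + (a + s + 1 - a) - 1 = d + s + 1 by omega,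
          show d + 1 + (a + s - a) - 1 = d + s by omega,
          show d + (a + s + 1 - a) - 1 = d + s by omega,
          show a + s + 1 - a = s + 1 by omega, show a + s - a = s by omega,
          qBinom_succ_succ hq, show d + (b + 1) = d + 1 + b by ring]
        have h1 := qPoch_ne_zero hq a
        field_simp
        ring
      have key2 : (-1) ^ (r + 1) * ((q ^ (d + 1)) ^ (r + 1) / q ^ (r + 1)) *
            qBinom q (d + 1 + (r + 1 - (r + 1)) - 1) (r + 1 - (r + 1)) / qPoch q (r + 1) *
              qElem q ((d + 1 + b : ℕ) - (r + 1 : ℕ)) =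
          q ^ (r + 1) * ((-1) ^ (r + 1) * ((q ^ d) ^ (r + 1) / q ^ (r + 1)) *
            qBinom q (d + (r + 1 - (r + 1)) - 1) (r + 1 - (r + 1)) / qPoch q (r + 1) *
              qElem q ((d + (b + 1) : ℕ) - (r + 1 : ℕ))) := by
        rw [Nat.sub_self, qBinom_zero_right hq, qBinom_zero_right hq,
          show d + (b + 1) = d + 1 + b by ring]
        have h1 := qPoch_ne_zero hq (r + 1)
        field_simp
        ring
      rw [Finset.sum_range_succ, key2, Finset.sum_congr rfl key, Finset.sum_add_distrib, ihr,
        ← Finset.mul_sum, add_assoc, ← mul_add, ← Finset.sum_range_succ, ihd (b + 1) (r + 1),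
        show d + (b + 1) = d + 1 + b by ring]
      have h1 := qPoch_ne_zero hq (d + 1 + b)
      have h2 : qBinom q (b + 1) (r + 1) = qBinom q b (r + 1) + q ^ b * qBinom q b r / q ^ r := by
        have := qBinom_succ_succ' hq b r
        field_simp
        linear_combination this
      rw [choose_two_succ, h2]
      field_simp
      ring

/-- This is q-binomial inversion, the orthogonality behind U·U⁻¹ = 1. The q-Pascal rule applied to
the factor with s, followed by a shift of b, makes the other factor a q-difference, which lowers r
along with s. -/
theorem sum_neg_one_pow_mul_qBinom_mul_qBinom {q : ℝ} (hq0 : q ≠ 0) (hq : |q| < 1) (r s n : ℕ)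
    (hn : s < n) :
    ∑ b ∈ Finset.range n, (-1) ^ b * (q ^ b.choose 2 / q ^ (b * r)) * qBinom q b r *
        qBinom q s b = if r = s then (-1) ^ r / q ^ (r + 1).choose 2 else 0 := by
  induction s generalizing r n with
  | zero =>
    rw [Finset.sum_eq_single_of_mem 0 (by simpa using hn)]
    · rcases r with _ | r
      · simp [qBinom_zero_right hq]
      · simp [qBinom_of_lt]
    · intro b _ hb
      rw [qBinom_of_lt (Nat.pos_of_ne_zero hb), mul_zero]
  | succ s ih =>
    obtain ⟨n, rfl⟩ : ∃ m, n = m + 1 := ⟨n - 1, by omega⟩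
    -- Summation by parts: the q-difference is moved from [s+1 choose b] onto g.
    have split : ∀ g : ℕ → ℝ, ∑ b ∈ Finset.range (n + 1), g b * qBinom q (s + 1) b =
        ∑ b ∈ Finset.range n, (q ^ b * g b + g (b + 1)) * qBinom q s b := by
      intro g
      have e : ∑ b ∈ Finset.range n, q ^ b * g b * qBinom q s b =
          ∑ b ∈ Finset.range (n + 1), q ^ b * g b * qBinom q s b := by
        rw [Finset.sum_range_succ, qBinom_of_lt (show s < n by omega), mul_zero, add_zero]
      simp only [add_mul]
      rw [Finset.sum_add_distrib, e, Finset.sum_range_succ', Finset.sum_range_succ' _ n,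
        qBinom_zero_right hq, qBinom_zero_right hq]
      have : ∀ b ∈ Finset.range n, g (b + 1) * qBinom q (s + 1) (b + 1) =
          q ^ (b + 1) * g (b + 1) * qBinom q s (b + 1) + g (b + 1) * qBinom q s b := by
        intro b _
        rw [qBinom_succ_succ hq]; ring
      rw [Finset.sum_congr rfl this, Finset.sum_add_distrib]
      ring
    rw [split]
    rcases r with _ | r
    · rw [if_neg (by omega)]
      refine Finset.sum_eq_zero fun b _ => ?_
      rw [qBinom_zero_right hq, qBinom_zero_right hq, choose_two_succ]
      simp only [mul_zero, pow_zero]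
      ring
    · have : ∀ b ∈ Finset.range n,
          (q ^ b * ((-1) ^ b * (q ^ b.choose 2 / q ^ (b * (r + 1))) * qBinom q b (r + 1)) +
            (-1) ^ (b + 1) * (q ^ (b + 1).choose 2 / q ^ ((b + 1) * (r + 1))) *
              qBinom q (b + 1) (r + 1)) * qBinom q s b =
          -(1 / q ^ (r + 1)) * ((-1) ^ b * (q ^ b.choose 2 / q ^ (b * r)) * qBinom q b r *
            qBinom q s b) := by
        intro b _
        rw [qBinom_succ_succ hq, choose_two_succ]
        field_simp
        ring
      rw [Finset.sum_congr rfl this, ← Finset.mul_sum, ih r n (by omega)]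
      by_cases h : r = s
      · rw [if_pos h, if_pos (by omega), choose_two_succ (r + 1)]
        field_simp
        ring
      · rw [if_neg h, if_neg (by omega), mul_zero]

/-- `[d+r-j-1 choose r-j]_q`, extended by `0` to `r < j`: the complete homogeneous symmetric
polynomial of degree `r - j` in `1, q, …, q^{d-1}`. -/
def qHomog (q : ℝ) (d j r : ℕ) : ℝ := if j ≤ r then qBinom q (d + (r - j) - 1) (r - j) else 0

theorem qHomog_self {q : ℝ} (hq : |q| < 1) (d r : ℕ) : qHomog q d r r = 1 := by
  rw [qHomog, if_pos le_rfl, Nat.sub_self, qBinom_zero_right hq]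

/-- The Toeplitz matrix of the elementary symmetric functions of `1, q, q², …`. -/
def elemToeplitz (q : ℝ) (d n : ℕ) : Matrix (Fin n) (Fin n) ℝ :=
  Matrix.of fun a b => qElem q ((d + (b : ℕ) : ℕ) - ((a : ℕ) : ℤ))

def toeplitzLower (q : ℝ) (d n : ℕ) : Matrix (Fin n) (Fin n) ℝ :=
  Matrix.of fun r a => (-1) ^ (a : ℕ) * ((q ^ d) ^ (a : ℕ) / q ^ (a : ℕ)) * qHomog q d a r /
    qPoch q a

def toeplitzUpper (q : ℝ) (d n : ℕ) : Matrix (Fin n) (Fin n) ℝ :=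
  Matrix.of fun r b =>
    (-1) ^ (r : ℕ) * (q ^ ((d + (b : ℕ)).choose 2 + (r : ℕ).choose 2) / q ^ ((b : ℕ) * r)) *
      qBinom q b r / qPoch q (d + b)

def toeplitzUpperInv (q : ℝ) (d n : ℕ) : Matrix (Fin n) (Fin n) ℝ :=
  Matrix.of fun b s =>
    (-1) ^ (b : ℕ) * q ^ (s : ℕ) * qPoch q (d + b) * qBinom q s b /
      (q ^ d.choose 2 * q ^ (d * (b : ℕ)))

theorem toeplitzLower_mul {q : ℝ} (hq0 : q ≠ 0) (hq : |q| < 1) (d n : ℕ) :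
    toeplitzLower q d n * elemToeplitz q d n = toeplitzUpper q d n := by
  ext r b
  rw [Matrix.mul_apply]
  simp only [toeplitzLower, elemToeplitz, toeplitzUpper, Matrix.of_apply]
  rw [← sum_qBinom_mul_qElem hq0 hq, Fin.sum_univ_eq_sum_range (fun a => (-1) ^ a *
    ((q ^ d) ^ a / q ^ a) * qHomog q d a r / qPoch q a * qElem q ((d + (b : ℕ) : ℕ) - (a : ℤ))) n]
  symm
  refine Finset.sum_subset_zero_on_sdiff (Finset.range_subset_range.2 (by omega)) ?_ ?_
  · intro a ha
    simp only [Finset.mem_sdiff, Finset.mem_range] at ha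
    rw [qHomog, if_neg (by omega)]; simp
  · intro a ha
    simp only [Finset.mem_range] at ha
    rw [qHomog, if_pos (by omega)]

theorem toeplitzUpper_mul {q : ℝ} (hq0 : q ≠ 0) (hq : |q| < 1) (d n : ℕ) :
    toeplitzUpper q d n * toeplitzUpperInv q d n = 1 := by
  ext r s
  rw [Matrix.mul_apply]
  simp only [toeplitzUpper, toeplitzUpperInv, Matrix.of_apply]
  have key : ∀ b : ℕ, (-1) ^ (r : ℕ) *
      (q ^ ((d + b).choose 2 + (r : ℕ).choose 2) / q ^ (b * (r : ℕ))) *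
      qBinom q b r / qPoch q (d + b) * ((-1) ^ b * q ^ (s : ℕ) * qPoch q (d + b) * qBinom q s b /
      (q ^ d.choose 2 * q ^ (d * b))) =
      ((-1) ^ (r : ℕ) * q ^ (r : ℕ).choose 2 * q ^ (s : ℕ)) *
        ((-1) ^ b * (q ^ b.choose 2 / q ^ (b * r)) * qBinom q b r * qBinom q s b) := by
    intro b
    have := qPoch_ne_zero hq (d + b)
    rw [choose_two_add]
    field_simp
    ring
  simp only [key]
  rw [Fin.sum_univ_eq_sum_range (fun b => ((-1) ^ (r : ℕ) * q ^ (r : ℕ).choose 2 * q ^ (s : ℕ)) *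
        ((-1) ^ b * (q ^ b.choose 2 / q ^ (b * r)) * qBinom q b r * qBinom q s b)) n,
    ← Finset.mul_sum, sum_neg_one_pow_mul_qBinom_mul_qBinom hq0 hq _ _ _ s.2]
  by_cases h : r = s
  · subst h
    rw [if_pos rfl, Matrix.one_apply_eq, choose_two_succ]
    have : ((-1 : ℝ) ^ (r : ℕ)) * (-1) ^ (r : ℕ) = 1 := by rw [← mul_pow]; simp
    field_simp
    rw [pow_add, pow_two, this, one_mul]
  · rw [if_neg (by omega), Matrix.one_apply_ne h, mul_zero]

/-- From LT = U and U·U⁻¹ = 1 follows L(T·U⁻¹) = 1. For square matrices a one-sided inverse is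
two-sided, so the factors may be rotated. -/
theorem elemToeplitz_mul {q : ℝ} (hq0 : q ≠ 0) (hq : |q| < 1) (d n : ℕ) :
    elemToeplitz q d n * (toeplitzUpperInv q d n * toeplitzLower q d n) = 1 := by
  rw [← Matrix.mul_assoc]
  apply mul_eq_one_comm.1
  rw [← Matrix.mul_assoc, toeplitzLower_mul hq0 hq, toeplitzUpper_mul hq0 hq]

theorem det_elemToeplitz {q : ℝ} (hq0 : q ≠ 0) (hq : |q| < 1) (d n : ℕ) :
    (elemToeplitz q d n).det =
      ∏ b ∈ Finset.range n, q ^ d.choose 2 * (qPoch q b / qPoch q (d + b)) := by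
  have h := congrArg Matrix.det (toeplitzLower_mul hq0 hq d n)
  rw [Matrix.det_mul, Matrix.det_of_isLowerTriangular (M := toeplitzLower q d n),
    Matrix.det_of_isUpperTriangular (M := toeplitzUpper q d n)] at h
  · simp only [toeplitzLower, toeplitzUpper, Matrix.of_apply] at h
    rw [Fin.prod_univ_eq_prod_range (fun a => (-1) ^ a * ((q ^ d) ^ a / q ^ a) * qHomog q d a a /
      qPoch q a) n, Fin.prod_univ_eq_prod_range (fun r => (-1) ^ r *
        (q ^ ((d + r).choose 2 + r.choose 2) / q ^ (r * r)) *
        qBinom q r r / qPoch q (d + r)) n] at h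
    have hP : ∏ a ∈ Finset.range n, (-1) ^ a * ((q ^ d) ^ a / q ^ a) * qHomog q d a a /
        qPoch q a ≠ 0 := by
      refine Finset.prod_ne_zero_iff.2 fun a _ => ?_
      have := qPoch_ne_zero hq a
      rw [qHomog_self hq]
      positivity
    apply mul_left_cancel₀ hP
    rw [h, ← Finset.prod_mul_distrib]
    refine Finset.prod_congr rfl fun b _ => ?_
    have h1 := qPoch_ne_zero hq b
    have h2 := qPoch_ne_zero hq (d + b)
    rw [qHomog_self hq, qBinom_self hq, choose_two_add, mul_self_eq_choose_two_add]
    field_simp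
    ring
  · intro r b hrb
    simp only [id] at hrb
    simp only [toeplitzUpper, Matrix.of_apply]
    rw [qBinom_of_lt (by simpa using hrb)]; simp
  · intro r b hrb
    simp only [toeplitzLower, Matrix.of_apply]
    rw [qHomog, if_neg (by simpa using hrb)]; simp

/-- Skipping row j accounts for the columns of length d+1, and skipping column k for the cells
removed by (k). The minor is thus a signed adjugate entry, that is, det T times an entry of U⁻¹L.
Its signs cancel, and the factor q^(-d(d-1)/2) in `toeplitzUpperInv` lowers the exponent N+1 of the
determinant to N. -/
theorem det_elemToeplitz_minor {q : ℝ} (hq0 : q ≠ 0) (hq : |q| < 1) (d N j k : ℕ)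
    (hj : j ≤ N) (hk : k ≤ N) :
    (Matrix.of fun c i : Fin N => qElem q (((if (i : ℕ) < j then d + 1 else d : ℕ) : ℤ) - i -
      (if (c : ℕ) < k then 1 else 0 : ℕ) + c)).det =
    (q ^ d.choose 2) ^ N * (∏ b ∈ Finset.range (N + 1), qPoch q b / qPoch q (d + b)) *
      ((q ^ d) ^ j / q ^ j / q ^ (d * k)) * (qPoch q (d + k) / qPoch q j) *
      ∑ r ∈ Finset.range (N + 1), q ^ r * qBinom q r k * qHomog q d j r := by
  set T := elemToeplitz q d (N + 1) with hT
  set k' : Fin (N + 1) := ⟨k, by omega⟩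
  set j' : Fin (N + 1) := ⟨j, by omega⟩
  have hM : (Matrix.of fun c i : Fin N => qElem q (((if (i : ℕ) < j then d + 1 else d : ℕ) : ℤ) -
      i - (if (c : ℕ) < k then 1 else 0 : ℕ) + c)) =
      (T.submatrix j'.succAbove k'.succAbove).transpose := by
    ext c i
    simp only [hT, elemToeplitz, Matrix.of_apply, Matrix.transpose_apply, Matrix.submatrix_apply]
    congr 1
    simp only [Fin.succAbove, Fin.lt_def, Fin.val_castSucc, j', k']
    split_ifs <;> simp <;> ring
  have hadj : T.adjugate = T.det • (toeplitzUpperInv q d (N + 1) * toeplitzLower q d (N + 1)) := by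
    rw [← Matrix.mul_one T.adjugate, ← elemToeplitz_mul hq0 hq d (N + 1), ← Matrix.mul_assoc,
      Matrix.adjugate_mul, Matrix.smul_mul, Matrix.one_mul]
  have h1 := Matrix.adjugate_fin_succ_eq_det_submatrix T k' j'
  have h2 : (T.submatrix j'.succAbove k'.succAbove).det = (-1) ^ (j + k) * T.adjugate k' j' := by
    rw [h1, ← mul_assoc, ← pow_add, Even.neg_one_pow ⟨j + k, rfl⟩, one_mul]
  rw [hM, Matrix.det_transpose, h2, hadj, hT, det_elemToeplitz hq0 hq, Matrix.smul_apply,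
    Matrix.mul_apply, smul_eq_mul, Finset.prod_mul_distrib, Finset.prod_const, Finset.card_range]
  simp only [toeplitzUpperInv, toeplitzLower, Matrix.of_apply, j', k']
  rw [Fin.sum_univ_eq_sum_range (fun r => (-1) ^ k * q ^ r * qPoch q (d + k) * qBinom q r k /
      (q ^ d.choose 2 * q ^ (d * k)) * ((-1) ^ j * ((q ^ d) ^ j / q ^ j) * qHomog q d j r /
      qPoch q j)) (N + 1), Finset.mul_sum, Finset.mul_sum, Finset.mul_sum]
  refine Finset.sum_congr rfl fun r _ => ?_
  have h3 := qPoch_ne_zero hq j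
  have : ((-1 : ℝ) ^ (j + k)) = (-1) ^ k * (-1) ^ j := by rw [pow_add, mul_comm]
  have hs : ∀ n : ℕ, ((-1 : ℝ) ^ n) * (-1) ^ n = 1 := fun n => by rw [← mul_pow]; simp
  calc _ = ((-1 : ℝ) ^ k * (-1) ^ k) * ((-1) ^ j * (-1) ^ j) *
        ((q ^ d.choose 2) ^ N * (∏ b ∈ Finset.range (N + 1), qPoch q b / qPoch q (d + b)) *
      ((q ^ d) ^ j / q ^ j / q ^ (d * k)) * (qPoch q (d + k) / qPoch q j) *
      (q ^ r * qBinom q r k * qHomog q d j r)) := by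
        rw [this]
        field_simp
        ring
    _ = _ := by rw [hs, hs, one_mul, one_mul]

/-! ### Dual Jacobi–Trudi identity in finitely many variables -/

/-- The elementary symmetric function of integral degree `z` in the variables
`x 0, …, x (V - 1)`. -/
def elemSymm : ℕ → (ℕ → ℝ) → ℤ → ℝ
  | 0, _, z => if z = 0 then 1 else 0
  | V + 1, x, z => elemSymm V (fun i => x (i + 1)) z + x 0 * elemSymm V (fun i => x (i + 1)) (z - 1)

/-- The dual Jacobi–Trudi determinant in `V` variables, for column lengths `l` and `m`. -/
def dualJacobiTrudi {n : ℕ} (V : ℕ) (x : ℕ → ℝ) (l m : Fin n → ℕ) : ℝ :=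
  (Matrix.of fun c i : Fin n => elemSymm V x ((l i : ℤ) - i - m c + c)).det

/-- Column lengths after one cell has been added to each of the columns in `S`. -/
def addCells {n : ℕ} (m : Fin n → ℕ) (S : Finset (Fin n)) (c : Fin n) : ℕ :=
  m c + if c ∈ S then 1 else 0

/-- Each row is a sum of two rows by the recursion for `elemSymm`. In the multilinear expansion, S
records the rows that take the part with `x 0`; lowering the degree by one there amounts to raising
`m` by one. -/
theorem dualJacobiTrudi_succ {n : ℕ} (V : ℕ) (x : ℕ → ℝ) (l m : Fin n → ℕ) :
    dualJacobiTrudi (V + 1) x l m =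
      ∑ S : Finset (Fin n), x 0 ^ S.card *
        dualJacobiTrudi V (fun i => x (i + 1)) l (addCells m S) := by
  set y : ℕ → ℝ := fun i => x (i + 1) with hy
  have h := (Matrix.detRowAlternating (n := Fin n) (R := ℝ)).map_add_univ
    (fun c i => x 0 * elemSymm V y ((l i : ℤ) - i - m c + c - 1))
    (fun c i => elemSymm V y ((l i : ℤ) - i - m c + c))
  have h0 : dualJacobiTrudi (V + 1) x l m = Matrix.detRowAlternating (n := Fin n) (R := ℝ)
      ((fun c i => x 0 * elemSymm V y ((l i : ℤ) - i - m c + c - 1)) +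
        (fun c i => elemSymm V y ((l i : ℤ) - i - m c + c))) := by
    unfold dualJacobiTrudi
    change Matrix.det _ = Matrix.det _
    congr 1
    ext c i
    simp only [Matrix.of_apply, elemSymm, Pi.add_apply]
    rw [add_comm]
  rw [h0, h]
  refine Finset.sum_congr rfl fun S _ => ?_
  have h1 := Matrix.det_mul_column (fun c : Fin n => if c ∈ S then x 0 else 1)
    (Matrix.of fun c i : Fin n => elemSymm V y ((l i : ℤ) - i - addCells m S c + c))
  rw [Finset.prod_ite_mem, Finset.univ_inter, Finset.prod_const] at h1
  rw [dualJacobiTrudi, ← h1]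
  change Matrix.det _ = Matrix.det _
  congr 1
  ext c i
  by_cases hc : c ∈ S
  · simp only [Finset.piecewise_eq_of_mem _ _ _ hc, Matrix.of_apply, if_pos hc, addCells]
    congr 2
    push_cast
    ring
  · simp only [Finset.piecewise_eq_of_notMem _ _ _ hc, Matrix.of_apply, if_neg hc, addCells,
      one_mul, add_zero]

/-- Since `m` is antitone and grows by at most one, a failure occurs at adjacent columns whose new
lengths differ by exactly one. The shift by the row index compensates this, so two rows of the
matrix coincide. -/
theorem dualJacobiTrudi_addCells_eq_zero {n : ℕ} (V : ℕ) (x : ℕ → ℝ) (l m : Fin n → ℕ)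
    (hm : Antitone m) (S : Finset (Fin n)) (hS : ¬ Antitone (addCells m S)) :
    dualJacobiTrudi V x l (addCells m S) = 0 := by
  rcases n with _ | n
  · exact absurd (fun a => a.elim0) hS
  rw [Fin.antitone_iff_succ_le] at hS
  push Not at hS
  obtain ⟨c, hc⟩ := hS
  have h1 : m c.succ ≤ m c.castSucc := hm (Fin.castSucc_lt_succ).le
  refine Matrix.det_zero_of_row_eq (i := c.castSucc) (j := c.succ)
    (Fin.castSucc_lt_succ).ne (funext fun i => ?_)
  simp only [Matrix.of_apply]
  congr 1
  have h2 : addCells m S c.succ = addCells m S c.castSucc + 1 := by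
    unfold addCells at hc ⊢
    split_ifs at hc ⊢ <;> omega
  rw [h2, Fin.val_succ, Fin.val_castSucc]
  push_cast
  ring

/-- With no variables the entries are Kronecker deltas comparing l i - i with m c - c. Both
sequences strictly decrease, so a permutation with a nonzero product is increasing, hence the
identity, which forces l = m. -/
theorem dualJacobiTrudi_zero {n : ℕ} (x : ℕ → ℝ) (l m : Fin n → ℕ) (hl : Antitone l)
    (hm : Antitone m) : dualJacobiTrudi 0 x l m = if l = m then 1 else 0 := by
  have hanti : ∀ {f : Fin n → ℕ}, Antitone f → ∀ {a b : Fin n}, a < b →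
      (f b : ℤ) - b < f a - a := by
    intro f hf a b hab
    have h1 := hf hab.le
    have h2 : (a : ℕ) < b := hab
    omega
  split_ifs with h
  · subst h
    rw [← Matrix.det_one (n := Fin n) (R := ℝ), dualJacobiTrudi]
    congr 1
    ext c i
    simp only [Matrix.of_apply, elemSymm, Matrix.one_apply]
    rcases lt_trichotomy c i with h | rfl | h
    · have := hanti hl h
      rw [if_neg (by omega), if_neg h.ne]
    · simp
    · have := hanti hl h
      rw [if_neg (by omega), if_neg h.ne']
  · rw [dualJacobiTrudi, Matrix.det_apply']
    refine Finset.sum_eq_zero fun σ _ => ?_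
    by_contra hne
    have hσ := Finset.prod_ne_zero_iff.1 (right_ne_zero_of_mul hne)
    simp only [Finset.mem_univ, true_implies, Matrix.of_apply, elemSymm, ne_eq, ite_eq_right_iff,
      one_ne_zero, imp_false, not_not] at hσ
    have hmono : StrictMono σ := by
      intro a b hab
      by_contra hle
      rcases (not_lt.1 hle).eq_or_lt with h' | h'
      · exact hab.ne' (σ.injective h')
      · have := hanti hm h'
        have := hanti hl hab
        have := hσ a
        have := hσ b
        omega
    have hid : (σ : Fin n → Fin n) = id :=
      (StrictMono.range_inj hmono strictMono_id).1 (by simp [σ.surjective.range_eq])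
    apply h
    funext c
    have := hσ c
    rw [hid, id] at this
    omega

/-- Fillings of the cells between the column lengths `m` and `l` by numbers smaller than `V`,
weakly increasing along rows and strictly increasing down columns. -/
structure IsColTableau {n : ℕ} (V : ℕ) (l m : Fin n → ℕ) (f : Fin n → ℕ → ℕ) : Prop where
  le : ∀ c, m c ≤ l c
  lt : ∀ c i, m c ≤ i → i < l c → f c i < V
  row : ∀ c₁ c₂ i, c₁ < c₂ → m c₁ ≤ i → i < l c₂ → f c₁ i ≤ f c₂ i
  col : ∀ c i₁ i₂, i₁ < i₂ → m c ≤ i₁ → i₂ < l c → f c i₁ < f c i₂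
  zero : ∀ c i, (l c ≤ i ∨ i < m c) → f c i = 0

instance {n V : ℕ} {l m : Fin n → ℕ} : Finite {f // IsColTableau V l m f} := by
  -- Reduction modulo V+1 rather than V keeps the target type available for V = 0; it loses nothing,
  -- as the entries on the shape are below V.
  refine Finite.of_injective
    (fun f => (fun c i => Fin.ofNat (V + 1) (f.1 c i) : (c : Fin n) → Fin (l c) → Fin (V + 1))) ?_
  rintro ⟨f, hf⟩ ⟨g, hg⟩ h
  refine Subtype.ext (funext fun c => funext fun i => ?_)
  by_cases hi : m c ≤ i ∧ i < l c
  · have h1 := congrArg Fin.val (congrFun (congrFun h c) ⟨i, hi.2⟩)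
    have h2 := hf.lt c i hi.1 hi.2
    have h3 := hg.lt c i hi.1 hi.2
    simp only [Fin.val_ofNat] at h1
    rwa [Nat.mod_eq_of_lt (by omega), Nat.mod_eq_of_lt (by omega)] at h1
  · change f c i = g c i
    rw [hf.zero c i (by omega), hg.zero c i (by omega)]

/-- The columns whose topmost cell contains `0`. -/
def zeroColumns {n : ℕ} (l m : Fin n → ℕ) (f : Fin n → ℕ → ℕ) : Finset (Fin n) :=
  Finset.univ.filter fun c => m c < l c ∧ f c (m c) = 0

def raiseEntries {n : ℕ} (l m : Fin n → ℕ) (g : Fin n → ℕ → ℕ) (c : Fin n) (i : ℕ) : ℕ :=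
  if m c ≤ i ∧ i < l c then g c i + 1 else 0

theorem IsColTableau.pos {n V : ℕ} {l m : Fin n → ℕ} {f : Fin n → ℕ → ℕ}
    (h : IsColTableau V l m f) (c : Fin n) (i : ℕ) (h1 : addCells m (zeroColumns l m f) c ≤ i)
    (h2 : i < l c) : 0 < f c i := by
  simp only [addCells, zeroColumns, Finset.mem_filter, Finset.mem_univ, true_and] at h1
  split_ifs at h1 with hc
  · exact lt_of_le_of_lt (Nat.zero_le _) (h.col c (m c) i (by omega) le_rfl h2)
  · rcases (show m c ≤ i by omega).eq_or_lt with rfl | h3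
    · omega
    · exact lt_of_le_of_lt (Nat.zero_le _) (h.col c (m c) i h3 le_rfl h2)

/-- The zeros form a horizontal strip: if two columns start at the same height and the right one
starts with `0`, weak increase along the row forces a `0` atop the left one. -/
theorem IsColTableau.antitone {n V : ℕ} {l m : Fin n → ℕ} (hl : Antitone l) (hm : Antitone m)
    {f : Fin n → ℕ → ℕ} (h : IsColTableau V l m f) :
    Antitone (addCells m (zeroColumns l m f)) := by
  intro a b hab
  rcases hab.eq_or_lt with rfl | hab
  · exact le_rfl
  have h1 := hl hab.le
  have h2 := hm hab.le
  have h3 := h.row a b (m b) hab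
  simp only [addCells, zeroColumns, Finset.mem_filter, Finset.mem_univ, true_and]
  by_cases e : m a = m b
  · rw [e]
    split_ifs with h4 h5 <;> omega
  · split_ifs <;> omega

theorem IsColTableau.lower {n V : ℕ} {l m : Fin n → ℕ}
    {f : Fin n → ℕ → ℕ} (h : IsColTableau (V + 1) l m f) :
    IsColTableau V l (addCells m (zeroColumns l m f)) fun c i => f c i - 1 := by
  have hge : ∀ c i, addCells m (zeroColumns l m f) c ≤ i → m c ≤ i := fun c i hi =>
    (Nat.le_add_right _ _).trans hi
  constructor
  · intro c
    have := h.le c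
    simp only [addCells, zeroColumns, Finset.mem_filter, Finset.mem_univ, true_and]
    split_ifs <;> omega
  · intro c i h1 h2
    have := h.pos c i h1 h2
    have := h.lt c i (hge c i h1) h2
    omega
  · intro a b i hab h1 h2
    exact Nat.sub_le_sub_right (h.row a b i hab (hge a i h1) h2) 1
  · intro c i₁ i₂ h12 h1 h2
    have := h.pos c i₁ h1 (h12.trans h2)
    have := h.col c i₁ i₂ h12 (hge c i₁ h1) h2
    omega
  · intro c i hi
    by_cases h1 : l c ≤ i ∨ i < m c
    · rw [h.zero c i h1]
    · rcases hi with hi | hi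
      · omega
      · simp only [addCells, zeroColumns, Finset.mem_filter, Finset.mem_univ, true_and] at hi
        split_ifs at hi with h2
        · rw [show i = m c by omega, h2.2]
        · omega

/-- The default `0` of `raiseEntries` also fills the newly freed cells, and antitonicity of the
enlarged lengths ensures that nothing positive stands to the left of such a zero. -/
theorem IsColTableau.raise {n V : ℕ} {l m : Fin n → ℕ}
    {S : Finset (Fin n)} (hS : Antitone (addCells m S)) {g : Fin n → ℕ → ℕ}
    (h : IsColTableau V l (addCells m S) g) :
    IsColTableau (V + 1) l m (raiseEntries l (addCells m S) g) := by
  have hge : ∀ c, m c ≤ addCells m S c := fun c => Nat.le_add_right _ _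
  have hle : ∀ c, addCells m S c ≤ m c + 1 := fun c => by
    unfold addCells; split_ifs <;> omega
  constructor
  · exact fun c => (hge c).trans (h.le c)
  · intro c i h1 h2
    unfold raiseEntries
    split_ifs with h3
    · exact Nat.succ_lt_succ (h.lt c i h3.1 h3.2)
    · omega
  · intro a b i hab h1 h2
    have h3 := hS hab.le
    unfold raiseEntries
    split_ifs with h4 h5 h5
    · exact Nat.succ_le_succ (h.row a b i hab h4.1 h2)
    · omega
    · omega
    · omega
  · intro c i₁ i₂ h12 h1 h2
    have := hle c
    unfold raiseEntries
    rw [if_pos (c := _ ∧ i₂ < l c) ⟨by omega, h2⟩]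
    split_ifs with h3
    · exact Nat.succ_lt_succ (h.col c i₁ i₂ h12 h3.1 h2)
    · omega
  · intro c i hi
    have := hge c
    unfold raiseEntries
    rw [if_neg (by omega)]

theorem zeroColumns_raiseEntries {n V : ℕ} {l m : Fin n → ℕ} {S : Finset (Fin n)}
    {g : Fin n → ℕ → ℕ} (h : IsColTableau V l (addCells m S) g) :
    zeroColumns l m (raiseEntries l (addCells m S) g) = S := by
  ext c
  have h1 := h.le c
  rw [zeroColumns, Finset.mem_filter]
  simp only [Finset.mem_univ, true_and, raiseEntries]
  unfold addCells at h1 ⊢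
  by_cases hc : c ∈ S
  · simp only [hc, if_true, iff_true] at h1 ⊢
    exact ⟨by omega, if_neg (by omega)⟩
  · simp only [hc, if_false, iff_false] at h1 ⊢
    rintro ⟨h2, h3⟩
    rw [if_pos ⟨by omega, h2⟩] at h3
    omega

/-- Peeling off the cells that contain `0`. -/
def colTableauSuccEquiv {n V : ℕ} {l m : Fin n → ℕ} (hl : Antitone l) (hm : Antitone m) :
    {f // IsColTableau (V + 1) l m f} ≃
      Σ S : {S : Finset (Fin n) // Antitone (addCells m S)},
        {g // IsColTableau V l (addCells m S.1) g} where
  toFun f := ⟨⟨zeroColumns l m f.1, f.2.antitone hl hm⟩, ⟨fun c i => f.1 c i - 1, f.2.lower⟩⟩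
  invFun p := ⟨raiseEntries l (addCells m p.1.1) p.2.1, p.2.2.raise p.1.2⟩
  left_inv f := by
    refine Subtype.ext (funext fun c => funext fun i => ?_)
    simp only [raiseEntries]
    split_ifs with h
    · have := f.2.pos c i h.1 h.2
      omega
    · by_cases h1 : l c ≤ i ∨ i < m c
      · rw [f.2.zero c i h1]
      · simp only [addCells, zeroColumns, Finset.mem_filter, Finset.mem_univ, true_and] at h
        split_ifs at h with h2
        · rw [show i = m c by omega, h2.2]
        · omega
  right_inv := by
    rintro ⟨⟨S, hS⟩, ⟨g, hg⟩⟩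
    replace hg : IsColTableau V l (addCells m S) g := hg
    have h1 := zeroColumns_raiseEntries hg
    have h2 : (fun c i => raiseEntries l (addCells m S) g c i - 1) = g := by
      funext c i
      unfold raiseEntries
      split_ifs with h
      · rfl
      · rw [hg.zero c i (by omega)]
    refine Sigma.ext (Subtype.ext h1) ?_
    dsimp only
    rw [Subtype.heq_iff_coe_eq]
    · exact h2
    · intro f
      rw [h1]

def colWeight {n : ℕ} (x : ℕ → ℝ) (l m : Fin n → ℕ) (f : Fin n → ℕ → ℕ) : ℝ :=
  ∏ c, ∏ i ∈ Finset.Ico (m c) (l c), x (f c i)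

theorem colWeight_raiseEntries {n V : ℕ} (x : ℕ → ℝ) {l m : Fin n → ℕ}
    {S : Finset (Fin n)} {g : Fin n → ℕ → ℕ} (h : IsColTableau V l (addCells m S) g) :
    colWeight x l m (raiseEntries l (addCells m S) g) =
      x 0 ^ S.card * colWeight (fun i => x (i + 1)) l (addCells m S) g := by
  have h1 : x 0 ^ S.card = ∏ c : Fin n, if c ∈ S then x 0 else 1 := by
    rw [Finset.prod_ite_mem, Finset.univ_inter, Finset.prod_const]
  rw [h1, colWeight, colWeight, ← Finset.prod_mul_distrib]
  refine Finset.prod_congr rfl fun c _ => ?_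
  have h3 : ∏ i ∈ Finset.Ico (addCells m S c) (l c), x (g c i + 1) =
      ∏ i ∈ Finset.Ico (addCells m S c) (l c), x (raiseEntries l (addCells m S) g c i) := by
    refine Finset.prod_congr rfl fun i hi => ?_
    rw [raiseEntries, if_pos (Finset.mem_Ico.1 hi)]
  rw [h3]
  have h2 := h.le c
  by_cases hc : c ∈ S
  · have e : addCells m S c = m c + 1 := by rw [addCells, if_pos hc]
    rw [if_pos hc, e, Finset.prod_eq_prod_Ico_succ_bot (by omega), raiseEntries, if_neg (by omega)]
  · have e : addCells m S c = m c := by rw [addCells, if_neg hc, add_zero]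
    rw [if_neg hc, one_mul, e]

/-- The dual Jacobi–Trudi identity in finitely many variables. -/
theorem tsum_colWeight {n : ℕ} (V : ℕ) (x : ℕ → ℝ) {l m : Fin n → ℕ} (hl : Antitone l)
    (hm : Antitone m) :
    ∑' f : {f // IsColTableau V l m f}, colWeight x l m f.1 = dualJacobiTrudi V x l m := by
  classical
  induction V generalizing x m with
  | zero =>
    rw [dualJacobiTrudi_zero x l m hl hm]
    split_ifs with h
    · subst h
      have h0 : IsColTableau 0 l l fun _ _ => 0 :=
        ⟨fun _ => le_rfl, fun _ _ _ _ => by omega, fun _ _ _ _ _ _ => le_rfl,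
          fun _ _ _ _ _ _ => by omega, fun _ _ _ => rfl⟩
      have : Unique {f // IsColTableau 0 l l f} :=
        ⟨⟨⟨_, h0⟩⟩, fun f => Subtype.ext (funext fun c => funext fun i => f.2.zero c i (by omega))⟩
      rw [tsum_fintype, Fintype.sum_unique]
      simp [colWeight]
    · have : IsEmpty {f // IsColTableau 0 l m f} := by
        refine ⟨fun f => h (funext fun c => ?_)⟩
        have h1 := f.2.le c
        have h2 := f.2.lt c (m c) le_rfl
        omega
      exact tsum_empty
  | succ V ih =>
    have : ∀ m : Fin n → ℕ, Fintype {f // IsColTableau V l m f} := fun _ => Fintype.ofFinite _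
    rw [dualJacobiTrudi_succ, ← (colTableauSuccEquiv hl hm).symm.tsum_eq, tsum_fintype,
      Fintype.sum_sigma]
    have e : ∀ S : {S : Finset (Fin n) // Antitone (addCells m S)},
        ∑ g : {g // IsColTableau V l (addCells m S.1) g},
          colWeight x l m ((colTableauSuccEquiv hl hm).symm ⟨S, g⟩).1 =
        x 0 ^ S.1.card * dualJacobiTrudi V (fun i => x (i + 1)) l (addCells m S.1) := by
      intro S
      rw [← ih (fun i => x (i + 1)) S.2, tsum_fintype, Finset.mul_sum]
      exact Finset.sum_congr rfl fun g _ => colWeight_raiseEntries x g.2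
    rw [Finset.sum_congr rfl fun S _ => e S, ← Finset.sum_subtype
      (Finset.univ.filter fun S : Finset (Fin n) => Antitone (addCells m S)) (by simp)
      (fun S => x 0 ^ S.card * dualJacobiTrudi V (fun i => x (i + 1)) l (addCells m S))]
    -- The subsets S that do not come from a tableau contribute vanishing determinants.
    refine Finset.sum_subset (Finset.filter_subset _ _) fun S _ hS => ?_
    rw [dualJacobiTrudi_addCells_eq_zero V _ l m hm S (by simpa using hS), mul_zero]

/-! ### Skew tableaux by columns, and infinitely many variables -/

/-- The entries of `T` are smaller than `V`. -/
def SkewTableau.EntriesLT {lam mu : YoungDiagram} (V : ℕ) (T : SkewTableau lam mu) : Prop :=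
  ∀ i c, (i, c) ∈ lam → (i, c) ∉ mu → T.entry i c < V

/-- The first `n` column lengths of a Young diagram. -/
def YoungDiagram.colLens (lam : YoungDiagram) (n : ℕ) (c : Fin n) : ℕ := lam.colLen c

theorem YoungDiagram.antitone_colLens (lam : YoungDiagram) (n : ℕ) : Antitone (lam.colLens n) :=
  fun _ _ h => lam.colLen_anti _ _ h

def skewTableauEquiv {lam mu : YoungDiagram} (V n : ℕ) (hmu : mu ≤ lam)
    (hn : ∀ i c, (i, c) ∈ lam → c < n) :
    {T : SkewTableau lam mu // T.EntriesLT V} ≃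
      {f // IsColTableau V (lam.colLens n) (mu.colLens n) f} where
  toFun T := ⟨fun c i => T.1.entry i c, by
    constructor
    · intro c
      by_contra h
      have h1 := YoungDiagram.mem_iff_lt_colLen.2 (not_le.1 h)
      exact lt_irrefl _ (YoungDiagram.mem_iff_lt_colLen.1 (hmu h1))
    · intro c i h1 h2
      exact T.2 i c (YoungDiagram.mem_iff_lt_colLen.2 h2)
        fun h => absurd (YoungDiagram.mem_iff_lt_colLen.1 h) (not_lt.2 h1)
    · intro a b i hab h1 h2
      exact T.1.row_weak hab (fun h => absurd (YoungDiagram.mem_iff_lt_colLen.1 h) (not_lt.2 h1))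
        (YoungDiagram.mem_iff_lt_colLen.2 h2)
    · intro c i₁ i₂ h12 h1 h2
      exact T.1.col_strict h12
        (fun h => absurd (YoungDiagram.mem_iff_lt_colLen.1 h) (not_lt.2 h1))
        (YoungDiagram.mem_iff_lt_colLen.2 h2)
    · intro c i h
      refine T.1.zeros (h.imp (fun h h' => ?_) fun h => YoungDiagram.mem_iff_lt_colLen.2 h)
      exact absurd (YoungDiagram.mem_iff_lt_colLen.1 h') (not_lt.2 h)⟩
  invFun f := ⟨{
      entry := fun i c => if h : c < n then f.1 ⟨c, h⟩ i else 0
      contained := hmu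
      row_weak := by
        intro i a b hab h1 h2
        have hb := hn _ _ h2
        rw [dif_pos hb, dif_pos (hab.trans hb)]
        rw [YoungDiagram.mem_iff_lt_colLen] at h1 h2
        exact f.2.row _ _ i hab (not_lt.1 h1) h2
      col_strict := by
        intro i₁ i₂ c h12 h1 h2
        have hc := hn _ _ h2
        rw [dif_pos hc, dif_pos hc]
        rw [YoungDiagram.mem_iff_lt_colLen] at h1 h2
        exact f.2.col _ _ _ h12 (not_lt.1 h1) h2
      zeros := by
        intro i c h
        rw [YoungDiagram.mem_iff_lt_colLen, YoungDiagram.mem_iff_lt_colLen] at h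
        split_ifs with hc
        · exact f.2.zero _ _ (h.imp_left not_lt.1)
        · rfl }, by
    intro i c h1 h2
    have hc := hn _ _ h1
    dsimp only
    rw [dif_pos hc]
    rw [YoungDiagram.mem_iff_lt_colLen] at h1 h2
    exact f.2.lt _ _ (not_lt.1 h2) h1⟩
  left_inv T := by
    refine Subtype.ext (SkewTableau.ext (funext fun i => funext fun c => ?_))
    dsimp only
    split_ifs with h
    · rfl
    · exact (T.1.zeros (Or.inl fun h' => h (hn _ _ h'))).symm
  right_inv f := by
    refine Subtype.ext (funext fun c => funext fun i => ?_)
    dsimp only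
    rw [dif_pos c.2]

theorem SkewTableau.weight_eq_colWeight {lam mu : YoungDiagram} (n : ℕ)
    (hn : ∀ i c, (i, c) ∈ lam → c < n) (x : ℕ → ℝ) (T : SkewTableau lam mu) :
    T.weight x = colWeight x (lam.colLens n) (mu.colLens n) fun c i => T.entry i c := by
  rw [SkewTableau.weight, colWeight, Finset.prod_sigma']
  symm
  refine Finset.prod_bij (fun p _ => (p.2, (p.1 : ℕ))) ?_ ?_ ?_ ?_
  · rintro ⟨c, i⟩ h
    simp only [Finset.mem_sigma, Finset.mem_univ, Finset.mem_Ico, true_and] at h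
    simp only [Finset.mem_sdiff, YoungDiagram.mem_cells, YoungDiagram.mem_iff_lt_colLen]
    exact ⟨h.2, not_lt.2 h.1⟩
  · rintro ⟨c, i⟩ _ ⟨c', i'⟩ _ h
    simp only [Prod.mk.injEq] at h
    obtain ⟨rfl, h⟩ := h
    obtain rfl := Fin.ext h
    rfl
  · rintro ⟨i, c⟩ h
    simp only [Finset.mem_sdiff, YoungDiagram.mem_cells] at h
    have hc := hn _ _ h.1
    simp only [YoungDiagram.mem_iff_lt_colLen] at h
    refine ⟨⟨⟨c, hc⟩, i⟩, ?_, rfl⟩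
    simp only [Finset.mem_sigma, Finset.mem_univ, Finset.mem_Ico, true_and]
    exact ⟨not_lt.1 h.2, h.1⟩
  · intros; rfl

/-- The tableaux with entries smaller than `V`. -/
theorem finite_setOf_entriesLT {lam mu : YoungDiagram} (V n : ℕ) (hmu : mu ≤ lam)
    (hn : ∀ i c, (i, c) ∈ lam → c < n) :
    {T : SkewTableau lam mu | T.EntriesLT V}.Finite :=
  have : Finite {T : SkewTableau lam mu // T.EntriesLT V} :=
    Finite.of_equiv _ (skewTableauEquiv V n hmu hn).symm
  Set.finite_coe_iff.1 this

theorem sum_weight_entriesLT {lam mu : YoungDiagram} (V n : ℕ) (hmu : mu ≤ lam)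
    (hn : ∀ i c, (i, c) ∈ lam → c < n) (x : ℕ → ℝ) :
    ∑ T ∈ (finite_setOf_entriesLT V n hmu hn).toFinset, T.weight x =
      dualJacobiTrudi V x (lam.colLens n) (mu.colLens n) := by
  rw [← tsum_colWeight V x (lam.antitone_colLens n) (mu.antitone_colLens n),
    ← (skewTableauEquiv V n hmu hn).tsum_eq]
  have : Fintype {T : SkewTableau lam mu // T.EntriesLT V} :=
    (finite_setOf_entriesLT V n hmu hn).fintype
  rw [tsum_fintype, Finset.sum_subtype _ (p := fun T : SkewTableau lam mu => T.EntriesLT V)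
    (by simp)]
  exact Finset.sum_congr rfl fun T _ => T.1.weight_eq_colWeight n hn x

/-- If the dual Jacobi–Trudi determinants in finitely many variables converge for the absolute
values of the variables, the skew Schur function converges absolutely, to their limit. -/
theorem hasSum_weight {lam mu : YoungDiagram} (n : ℕ) (hmu : mu ≤ lam)
    (hn : ∀ i c, (i, c) ∈ lam → c < n) (x : ℕ → ℝ) {a b : ℝ}
    (habs : Tendsto (fun V => dualJacobiTrudi V (fun i => |x i|) (lam.colLens n) (mu.colLens n))
      atTop (𝓝 a))
    (h : Tendsto (fun V => dualJacobiTrudi V x (lam.colLens n) (mu.colLens n)) atTop (𝓝 b)) :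
    HasSum (fun T : SkewTableau lam mu => T.weight x) b := by
  have hmono : Monotone fun V => (finite_setOf_entriesLT (mu := mu) V n hmu hn).toFinset := by
    intro V W hVW
    refine Set.Finite.toFinset_subset_toFinset.2 fun T hT i c h1 h2 => ?_
    exact (hT i c h1 h2).trans_le hVW
  have hex : ∀ T : SkewTableau lam mu, ∃ V,
      T ∈ (finite_setOf_entriesLT (mu := mu) V n hmu hn).toFinset := by
    intro T
    refine ⟨(lam.cells.sup fun c => T.entry c.1 c.2) + 1, ?_⟩
    rw [Set.Finite.mem_toFinset]
    intro i c h1 _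
    exact Nat.lt_succ_of_le (Finset.le_sup (f := fun c : ℕ × ℕ => T.entry c.1 c.2)
      (b := (i, c)) h1)
  have htend := tendsto_atTop_finset_of_monotone hmono hex
  obtain ⟨B, hB⟩ := habs.bddAbove_range
  have hsum : Summable fun T : SkewTableau lam mu => T.weight x := by
    -- Every finite set of tableaux lies in some stage of the exhaustion by bounded entries, where
    -- the sum of absolute values is a determinant in |x i|; convergent determinants are bounded.
    refine Summable.of_abs (summable_of_sum_le (c := B) (fun T => abs_nonneg _) fun u => ?_)
    obtain ⟨V, hV⟩ := (htend.eventually (eventually_ge_atTop u)).exists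
    have e : ∀ T : SkewTableau lam mu, |T.weight x| = T.weight fun i => |x i| := fun T =>
      Finset.abs_prod _ _
    simp only [e]
    refine le_trans ?_ (hB ⟨V, rfl⟩)
    dsimp only
    rw [← sum_weight_entriesLT V n hmu hn]
    refine Finset.sum_le_sum_of_subset_of_nonneg hV fun T _ _ => ?_
    rw [← e]
    exact abs_nonneg _
  have h1 := hsum.hasSum.comp htend
  have h2 : (fun s : Finset (SkewTableau lam mu) => ∑ T ∈ s, T.weight x) ∘
      (fun V => (finite_setOf_entriesLT (mu := mu) V n hmu hn).toFinset) =
      fun V => dualJacobiTrudi V x (lam.colLens n) (mu.colLens n) :=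
    funext fun V => sum_weight_entriesLT V n hmu hn x
  rw [h2] at h1
  rw [tendsto_nhds_unique h h1]
  exact hsum.hasSum

/-! ### Principal specialization -/

/-- A form of the q-binomial theorem. The factor `y` is kept general because removing the first
variable replaces `y` by `y * q`. -/
theorem elemSymm_geometric {q : ℝ} (hq : |q| < 1) (V : ℕ) (y : ℝ) (z : ℤ) :
    elemSymm V (fun i => y * q ^ i) z =
      if z < 0 then 0 else y ^ z.toNat * q ^ z.toNat.choose 2 * qBinom q V z.toNat := by
  induction V generalizing y z with
  | zero =>
    rw [elemSymm]
    rcases lt_trichotomy z 0 with h | rfl | h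
    · rw [if_pos h, if_neg h.ne]
    · simp [qBinom_self hq]
    · rw [if_neg h.ne', if_neg h.not_gt, qBinom_of_lt (by omega), mul_zero]
  | succ V ih =>
    have e : (fun i => y * q ^ (i + 1)) = fun i => (y * q) * q ^ i := by
      funext i; ring
    rw [elemSymm, e, ih, ih]
    rcases lt_trichotomy z 0 with h | rfl | h
    · rw [if_pos h, if_pos h, if_pos (by omega)]; simp
    · simp [qBinom_zero_right hq]
    · obtain ⟨n, rfl⟩ : ∃ n : ℕ, z = (n + 1 : ℕ) := ⟨z.toNat - 1, by omega⟩
      rw [if_neg (by omega), if_neg (by omega), if_neg (by omega), Int.toNat_natCast,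
        show ((n + 1 : ℕ) : ℤ) - 1 = (n : ℕ) by push_cast; ring, Int.toNat_natCast,
        qBinom_succ_succ hq, choose_two_succ]
      ring

theorem multipliable_qPochInf {q : ℝ} (hq : |q| < 1) :
    Multipliable fun i : ℕ => 1 - q ^ (i + 1) := by
  have h : Summable fun i : ℕ => ‖-q ^ (i + 1)‖ := by
    simp only [norm_neg, norm_pow, Real.norm_eq_abs]
    exact (summable_nat_add_iff 1).2 (summable_geometric_of_lt_one (abs_nonneg q) hq)
  simpa [sub_eq_add_neg] using multipliable_one_add_of_summable h

theorem tendsto_qPoch {q : ℝ} (hq : |q| < 1) :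
    Tendsto (qPoch q) atTop (𝓝 (qPochInf q)) := by
  have h := (multipliable_qPochInf hq).hasProd.tendsto_prod_nat
  refine h.congr fun n => ?_
  induction n with
  | zero => simp [qPoch_zero]
  | succ n ih => rw [Finset.prod_range_succ, ih, qPoch_succ]

theorem qPochInf_ne_zero {q : ℝ} (hq : |q| < 1) : qPochInf q ≠ 0 := by
  have h : Summable fun i : ℕ => ‖-q ^ (i + 1)‖ := by
    simp only [norm_neg, norm_pow, Real.norm_eq_abs]
    exact (summable_nat_add_iff 1).2 (summable_geometric_of_lt_one (abs_nonneg q) hq)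
  have := tprod_one_add_ne_zero_of_summable (f := fun i : ℕ => -q ^ (i + 1))
    (fun i => by simpa [sub_eq_add_neg] using one_sub_pow_ne_zero hq i) h
  simpa [qPochInf, sub_eq_add_neg] using this

theorem tendsto_qBinom_left {q : ℝ} (hq : |q| < 1) (k : ℕ) :
    Tendsto (fun n => qBinom q n k) atTop (𝓝 (1 / qPoch q k)) := by
  rw [← tendsto_add_atTop_iff_nat k]
  have h1 := tendsto_qPoch hq
  have h2 := (tendsto_add_atTop_iff_nat k).2 h1
  have hk := qPoch_ne_zero hq k
  have hinf := qPochInf_ne_zero hq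
  have h3 := h2.div (h1.const_mul (qPoch q k)) (mul_ne_zero hk hinf)
  have e : qPochInf q / (qPoch q k * qPochInf q) = 1 / qPoch q k := by field_simp
  rw [e] at h3
  exact h3.congr fun n => (qBinom_add hq n k).symm

theorem tendsto_elemSymm_geometric {q : ℝ} (hq : |q| < 1) (z : ℤ) :
    Tendsto (fun V => elemSymm V (fun i => q ^ i) z) atTop (𝓝 (qElem q z)) := by
  have h := fun V => elemSymm_geometric hq V 1 z
  simp only [one_pow, one_mul] at h
  simp only [h, qElem]
  split_ifs
  · exact tendsto_const_nhds
  · rw [← mul_one_div]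
    exact (tendsto_qBinom_left hq _).const_mul _

/-- The principal specialization of the dual Jacobi–Trudi identity. -/
theorem hasSum_weight_geometric {q : ℝ} (hq : |q| < 1) {lam mu : YoungDiagram} (n : ℕ)
    (hmu : mu ≤ lam) (hn : ∀ i c, (i, c) ∈ lam → c < n) :
    HasSum (fun T : SkewTableau lam mu => T.weight fun i => q ^ i)
      (Matrix.of fun c i : Fin n =>
        qElem q ((lam.colLens n i : ℤ) - i - mu.colLens n c + c)).det := by
  have key : ∀ p : ℝ, |p| < 1 →
      Tendsto (fun V => dualJacobiTrudi V (fun i => p ^ i) (lam.colLens n) (mu.colLens n)) atTop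
        (𝓝 (Matrix.of fun c i : Fin n =>
          qElem p ((lam.colLens n i : ℤ) - i - mu.colLens n c + c)).det) := by
    intro p hp
    refine ((continuous_id.matrix_det).tendsto _).comp ?_
    exact tendsto_pi_nhds.2 fun c => tendsto_pi_nhds.2 fun i => tendsto_elemSymm_geometric hp _
  have habs := key |q| (by rwa [abs_abs])
  simp only [← abs_pow] at habs
  exact hasSum_weight n hmu hn _ habs (key q hq)

/-! ### The shape (N^d, j)/(k) and the exact formula -/

theorem mem_rectAddRow {d N j i c : ℕ} :
    (i, c) ∈ rectAddRow d N j ↔ (i < d ∧ c < N) ∨ (i < d + 1 ∧ c < j) := by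
  rw [rectAddRow, YoungDiagram.mem_sup, mem_rectDiagram, mem_rectDiagram]

theorem colLens_rectAddRow {d N j : ℕ} (c : Fin N) :
    (rectAddRow d N j).colLens N c = if (c : ℕ) < j then d + 1 else d := by
  refine eq_of_forall_lt_iff fun i => ?_
  rw [YoungDiagram.colLens, ← YoungDiagram.mem_iff_lt_colLen, mem_rectAddRow]
  have := c.2
  split_ifs <;> omega

theorem colLens_oneRow {k N : ℕ} (c : Fin N) :
    (oneRow k).colLens N c = if (c : ℕ) < k then 1 else 0 := by
  refine eq_of_forall_lt_iff fun i => ?_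
  rw [YoungDiagram.colLens, ← YoungDiagram.mem_iff_lt_colLen, oneRow, mem_rectDiagram]
  split_ifs <;> omega

theorem oneRow_le_rectAddRow {d N j k : ℕ} (hd : 1 ≤ d) (hk : k ≤ N) :
    oneRow k ≤ rectAddRow d N j := by
  rintro ⟨i, c⟩ h
  change (i, c) ∈ rectDiagram 1 k at h
  rw [mem_rectDiagram] at h
  rw [mem_rectAddRow]
  omega

theorem hasSum_weight_rectAddRow {q : ℝ} (hq0 : q ≠ 0) (hq : |q| < 1) {d N j k : ℕ}
    (hd : 1 ≤ d) (hj : j ≤ N) (hk : k ≤ N) :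
    HasSum (fun T : SkewTableau (rectAddRow d N j) (oneRow k) => T.weight fun i => q ^ i)
      ((q ^ d.choose 2) ^ N * (∏ b ∈ Finset.range (N + 1), qPoch q b / qPoch q (d + b)) *
        ((q ^ d) ^ j / q ^ j / q ^ (d * k)) * (qPoch q (d + k) / qPoch q j) *
        ∑ r ∈ Finset.range (N + 1), q ^ r * qBinom q r k * qHomog q d j r) := by
  have h := hasSum_weight_geometric hq N (oneRow_le_rectAddRow (j := j) hd hk)
    (fun i c h => by rw [mem_rectAddRow] at h; omega)
  simp only [colLens_rectAddRow, colLens_oneRow] at h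
  rwa [← det_elemToeplitz_minor hq0 hq d N j k hj hk]

theorem qBarnes_succ (q : ℝ) (n : ℕ) :
    qBarnes q (n + 1) = (∏ i ∈ Finset.range n, qPoch q i) / (1 - q) ^ n.choose 2 := by
  have h : qBarnes q (n + 1) = ∏ i ∈ Finset.range n, qGamma q (i + 1) := by
    rcases n with _ | n
    · simp [qBarnes]
    · rw [qBarnes, Finset.prod_range_eq_mul_Ico _ (by omega)]
      simp [qGamma, qPoch_zero]
  have e : ∀ m : ℕ, ∏ i ∈ Finset.range m, (1 - q) ^ i = (1 - q) ^ m.choose 2 := by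
    intro m
    induction m with
    | zero => simp
    | succ m ih => rw [Finset.prod_range_succ, ih, choose_two_succ, pow_add]
  rw [h, ← e, ← Finset.prod_div_distrib]
  rfl

/-- The quotient of Pochhammer products is immediate from `qBarnes_succ`; the powers of 1-q match
because binom(d+N+1, 2) - binom(d, 2) - binom(N+1, 2) = d(N+1). -/
theorem qBarnes_div {q : ℝ} (hq : |q| < 1) (d N : ℕ) :
    qBarnes q (N + 2) * qBarnes q (d + 1) / qBarnes q (d + N + 2) / (1 - q) ^ (d * (N + 1)) =
      ∏ b ∈ Finset.range (N + 1), qPoch q b / qPoch q (d + b) := by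
  have h0 := one_sub_ne_zero_of_abs_lt hq
  have hp : ∀ s : Finset ℕ, ∏ i ∈ s, qPoch q i ≠ 0 := fun s =>
    Finset.prod_ne_zero_iff.2 fun i _ => qPoch_ne_zero hq i
  have hp' : ∏ b ∈ Finset.range (N + 1), qPoch q (d + b) ≠ 0 :=
    Finset.prod_ne_zero_iff.2 fun i _ => qPoch_ne_zero hq _
  rw [show N + 2 = (N + 1) + 1 by ring, show d + N + 2 = (d + (N + 1)) + 1 by ring,
    qBarnes_succ, qBarnes_succ, qBarnes_succ, Finset.prod_range_add _ d (N + 1), choose_two_add d (N + 1),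
    Finset.prod_div_distrib]
  have := hp (Finset.range d)
  have := hp (Finset.range (N + 1))
  field_simp
  ring

theorem mul_sub_one_ediv_two (d : ℕ) : (d : ℤ) * (d - 1) / 2 = (d.choose 2 : ℕ) := by
  have h := mul_self_eq_choose_two_add d
  zify at h
  have : (d : ℤ) * (d - 1) = 2 * (d.choose 2 : ℕ) := by
    rw [mul_sub, h]; ring
  rw [this]
  omega

theorem sum_range_qBinom_mul_qHomog {q : ℝ} (hq : |q| < 1) (d j k N : ℕ) :
    ∑ r ∈ Finset.range (N + 1), q ^ r * qBinom q r k * qHomog q d j r =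
      ∑ r ∈ Finset.Icc (max j k) N,
        q ^ r * qBinom q r (r - k) * qBinom q (d + r - j - 1) (r - j) := by
  symm
  refine Finset.sum_subset_zero_on_sdiff ?_ ?_ ?_
  · intro r hr
    rw [Finset.mem_Icc] at hr
    rw [Finset.mem_range]
    omega
  · intro r hr
    simp only [Finset.mem_sdiff, Finset.mem_range, Finset.mem_Icc, max_le_iff] at hr
    rcases lt_or_ge r k with h | h
    · rw [qBinom_of_lt h]; simp
    · rw [qHomog, if_neg (by omega), mul_zero]
  · intro r hr
    rw [Finset.mem_Icc, max_le_iff] at hr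
    obtain ⟨s, rfl⟩ := Nat.exists_eq_add_of_le hr.1.2
    rw [qHomog, if_pos hr.1.1, Nat.add_sub_cancel_left, qBinom_symm_add hq,
      show d + (k + s) - j - 1 = d + (k + s - j) - 1 by omega]

theorem hasSum_weight_rectAddRow' {q : ℝ} (hq0 : q ≠ 0) (hq : |q| < 1) {d N j k : ℕ}
    (hd : 1 ≤ d) (hj : j ≤ N) (hk : k ≤ N) :
    HasSum (fun T : SkewTableau (rectAddRow d N j) (oneRow k) => T.weight fun i => q ^ i)
      (q ^ (((d : ℤ) - 1) * j - d * k + (d : ℤ) * (d - 1) / 2 * N) / (1 - q) ^ (d * (N + 1)) *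
          (qBarnes q (N + 2) * qBarnes q (d + 1) / qBarnes q (d + N + 2)) *
          (qPoch q (d + k) / qPoch q j) *
          ∑ r ∈ Finset.Icc (max j k) N,
            q ^ r * qBinom q r (r - k) * qBinom q (d + r - j - 1) (r - j)) := by
  convert! hasSum_weight_rectAddRow hq0 hq hd hj hk using 1
  rw [sum_range_qBinom_mul_qHomog hq, ← qBarnes_div hq, mul_sub_one_ediv_two]
  have e : q ^ (((d : ℤ) - 1) * j - d * k + (d.choose 2 : ℕ) * N) =
      (q ^ d.choose 2) ^ N * ((q ^ d) ^ j / q ^ j / q ^ (d * k)) := by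
    rw [zpow_add₀ hq0, zpow_sub₀ hq0, sub_mul, zpow_sub₀ hq0, one_mul, ← Nat.cast_mul,
      ← Nat.cast_mul, ← Nat.cast_mul]
    simp only [zpow_natCast, pow_mul]
    ring
  rw [e]
  ring

/-! ### Telescoping relations and the limit of the sum over r -/

theorem qBinom_succ_succ_mul {q : ℝ} (hq : |q| < 1) (n k : ℕ) :
    qBinom q (n + 1) (k + 1) * (1 - q ^ (k + 1)) = (1 - q ^ (n + 1)) * qBinom q n k := by
  rcases lt_or_ge n k with h | h
  · rw [qBinom_of_lt h, qBinom_of_lt (by omega)]; simp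
  · obtain ⟨s, rfl⟩ := Nat.exists_eq_add_of_le' h
    rw [add_assoc, qBinom_add hq, qBinom_add hq, ← add_assoc, qPoch_succ, qPoch_succ]
    have h1 := qPoch_ne_zero hq s
    have h2 := qPoch_ne_zero hq k
    have h3 := one_sub_pow_ne_zero hq k
    field_simp

theorem qHomog_add {q : ℝ} (hq : |q| < 1) (e j m : ℕ) :
    qHomog q (e + 1) j (j + m) = qPoch q (e + m) / (qPoch q m * qPoch q e) := by
  rw [qHomog, if_pos (by omega), Nat.add_sub_cancel_left,
    show e + 1 + m - 1 = e + m by omega, qBinom_add hq]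

theorem qHomog_of_lt {q : ℝ} {d j r : ℕ} (h : r < j) : qHomog q d j r = 0 := by
  rw [qHomog, if_neg (by omega)]

/-- The partial sums `∑_{r<n} q^r [r choose k] [d+r-j-1 choose r-j]`. -/
def partialSum (q : ℝ) (d j k n : ℕ) : ℝ :=
  ∑ r ∈ Finset.range n, q ^ r * qBinom q r k * qHomog q d j r

/-- The boundary term of the telescoping relations between the partial sums. -/
def boundaryTerm (q : ℝ) (d j k n : ℕ) : ℝ :=
  qBinom q n k * qHomog q d j n * (q ^ (j + k) - q ^ n)

theorem partialSum_zero_right {q : ℝ} (hq : |q| < 1) (e j n : ℕ) :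
    (1 - q ^ (e + 1)) * partialSum q (e + 1) j 0 n = boundaryTerm q (e + 1) j 0 n := by
  induction n with
  | zero =>
    rcases j with _ | j
    · simp [partialSum, boundaryTerm]
    · simp [partialSum, boundaryTerm, qHomog_of_lt]
  | succ r ih =>
    rw [partialSum, Finset.sum_range_succ, mul_add, ← partialSum, ih]
    simp only [boundaryTerm, qBinom_zero_right hq]
    rcases lt_trichotomy (r + 1) j with h | rfl | h
    · rw [qHomog_of_lt h, qHomog_of_lt (by omega)]; simp
    · rw [qHomog_of_lt (by omega)]; simp
    · obtain ⟨m, rfl⟩ := Nat.exists_eq_add_of_le (show j ≤ r by omega)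
      rw [add_assoc, qHomog_add hq, qHomog_add hq, ← add_assoc, ← add_assoc, qPoch_succ, qPoch_succ]
      have h1 := qPoch_ne_zero hq m
      have h2 := qPoch_ne_zero hq e
      have h3 := one_sub_pow_ne_zero hq m
      field_simp
      ring

theorem partialSum_zero_left {q : ℝ} (hq : |q| < 1) (e k n : ℕ) :
    (1 - q ^ (e + 1 + k)) * partialSum q (e + 1) 0 k n = boundaryTerm q (e + 1) 0 k n := by
  induction n with
  | zero =>
    rcases k with _ | k
    · simp [partialSum, boundaryTerm]
    · simp [partialSum, boundaryTerm, qBinom_of_lt]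
  | succ r ih =>
    rw [partialSum, Finset.sum_range_succ, mul_add, ← partialSum, ih]
    simp only [boundaryTerm]
    rcases lt_trichotomy (r + 1) k with h | rfl | h
    · rw [qBinom_of_lt h, qBinom_of_lt (by omega)]; simp
    · rw [qBinom_of_lt (by omega)]; simp
    · have e1 := qHomog_add hq e 0 r
      have e2 := qHomog_add hq e 0 (r + 1)
      rw [zero_add] at e1 e2
      obtain ⟨m, rfl⟩ := Nat.exists_eq_add_of_le' (show k ≤ r by omega)
      rw [e1, e2, show m + k + 1 = m + 1 + k by ring, qBinom_add hq, qBinom_add hq,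
        show e + (m + 1 + k) = e + (m + k) + 1 by ring, show m + 1 + k = m + k + 1 by ring,
        qPoch_succ, qPoch_succ, qPoch_succ]
      have h1 := qPoch_ne_zero hq m
      have h2 := qPoch_ne_zero hq e
      have h3 := qPoch_ne_zero hq k
      have h4 := one_sub_pow_ne_zero hq m
      have h5 := one_sub_pow_ne_zero hq (m + k)
      have h6 := qPoch_ne_zero hq (m + k)
      field_simp
      ring

/-- The relation is found by telescoping: the increment of the boundary term in n is exactly the
difference of the two summands. Iterating it reaches j = 0 or k = 0, where `partialSum_zero_left`
and `partialSum_zero_right` sum in closed form. -/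
theorem partialSum_succ_succ {q : ℝ} (hq0 : q ≠ 0) (hq : |q| < 1) (e j k n : ℕ) :
    (1 - q ^ (e + 1 + (k + 1))) * partialSum q (e + 1) (j + 1) (k + 1) n =
      q * (1 - q ^ (j + 1)) * partialSum q (e + 1) j k n +
        boundaryTerm q (e + 1) (j + 1) (k + 1) n := by
  induction n with
  | zero => simp [partialSum, boundaryTerm, qBinom_of_lt]
  | succ r ih =>
    rw [partialSum, Finset.sum_range_succ, mul_add, ← partialSum, ih, partialSum, partialSum,
      Finset.sum_range_succ]
    simp only [boundaryTerm]
    have hk := one_sub_pow_ne_zero hq k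
    have hZ : qBinom q (r + 1) (k + 1) = (1 - q ^ (r + 1)) * qBinom q r k / (1 - q ^ (k + 1)) :=
      eq_div_of_mul_eq hk (qBinom_succ_succ_mul hq r k)
    rcases lt_trichotomy r j with h | rfl | h
    · rw [qHomog_of_lt h, qHomog_of_lt (by omega), qHomog_of_lt (by omega)]; simp
    · rw [qHomog_of_lt (by omega), qHomog_self hq, qHomog_self hq, hZ]
      field_simp
      ring
    · obtain ⟨m, rfl⟩ := Nat.exists_eq_add_of_le (show j + 1 ≤ r by omega)
      -- Absorption and the q-Pascal rule express every q-binomial coefficient through [r choose k],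
      -- leaving a rational identity.
      have hY : qBinom q (j + 1 + m) (k + 1) =
          ((1 - q ^ (j + 1 + m + 1)) * qBinom q (j + 1 + m) k / (1 - q ^ (k + 1)) -
            qBinom q (j + 1 + m) k) / q ^ (k + 1) := by
        rw [← hZ, qBinom_succ_succ hq]
        field_simp
        ring
      rw [hZ, hY, show j + 1 + m + 1 = j + 1 + (m + 1) by ring, qHomog_add hq, qHomog_add hq,
        show qHomog q (e + 1) j (j + 1 + m) = qHomog q (e + 1) j (j + (m + 1)) by
          rw [show j + 1 + m = j + (m + 1) by ring], qHomog_add hq,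
        show e + (m + 1) = e + m + 1 by ring, qPoch_succ, qPoch_succ]
      have h1 := qPoch_ne_zero hq m
      have h2 := qPoch_ne_zero hq e
      have h4 := one_sub_pow_ne_zero hq m
      field_simp
      ring

theorem tendsto_boundaryTerm {q : ℝ} (hq : |q| < 1) (e j k : ℕ) :
    Tendsto (boundaryTerm q (e + 1) j k) atTop
      (𝓝 (q ^ (j + k) / (qPoch q k * qPoch q e))) := by
  have h1 := tendsto_qBinom_left hq k
  have h2 : Tendsto (qHomog q (e + 1) j) atTop (𝓝 (1 / qPoch q e)) := by
    rw [← tendsto_add_atTop_iff_nat j]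
    have := (tendsto_add_atTop_iff_nat e).2 (tendsto_qBinom_left hq e)
    exact this.congr fun n => by
      rw [add_comm n j, qHomog_add hq, qBinom_add hq n e, add_comm e n, mul_comm (qPoch q e)]
  have h3 : Tendsto (fun n => q ^ (j + k) - q ^ n) atTop (𝓝 (q ^ (j + k) - 0)) :=
    tendsto_const_nhds.sub (tendsto_pow_atTop_nhds_zero_of_abs_lt_one hq)
  have e1 : q ^ (j + k) / (qPoch q k * qPoch q e) =
      1 / qPoch q k * (1 / qPoch q e) * (q ^ (j + k) - 0) := by
    rw [sub_zero]; ring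
  rw [e1]
  exact (h1.mul h2).mul h3

/-- The sum over `r` in the asymptotic formula. -/
def limitSum (q : ℝ) (d j k : ℕ) : ℝ :=
  ∑ r ∈ Finset.range (min j k + 1),
    (q ^ r)⁻¹ * (1 / qPoch q (j - r)) * qBinom q (d + k - r - 1) (k - r)

theorem limitSum_zero_left {q : ℝ} (hq : |q| < 1) (e k : ℕ) :
    limitSum q (e + 1) 0 k = qPoch q (e + k) / (qPoch q k * qPoch q e) := by
  simp [limitSum, qPoch_zero]
  rw [qBinom_add hq]

theorem limitSum_zero_right {q : ℝ} (hq : |q| < 1) (e j : ℕ) :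
    limitSum q (e + 1) j 0 = 1 / qPoch q j := by
  simp [limitSum, qBinom_zero_right hq]

theorem limitSum_succ_succ {q : ℝ} (hq0 : q ≠ 0) (hq : |q| < 1) (e j k : ℕ) :
    limitSum q (e + 1) (j + 1) (k + 1) =
      qPoch q (e + (k + 1)) / (qPoch q (k + 1) * qPoch q e) / qPoch q (j + 1) +
        limitSum q (e + 1) j k / q := by
  rw [limitSum, Nat.add_min_add_right, Finset.sum_range_succ', limitSum, Finset.sum_div, add_comm]
  congr 1
  · simp only [pow_zero, Nat.sub_zero]
    rw [show e + 1 + (k + 1) - 1 = e + (k + 1) by omega, qBinom_add hq]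
    ring
  · refine Finset.sum_congr rfl fun r _ => ?_
    rw [Nat.add_sub_add_right, Nat.add_sub_add_right,
      show e + 1 + (k + 1) - (r + 1) - 1 = e + 1 + k - r - 1 by omega]
    field_simp
    ring

/-- Letting n tend to infinity in the telescoping relations turns them into the recursion and
initial values of `limitSum`, up to the prefactor; induction on j with k free then suffices. -/
theorem tendsto_partialSum {q : ℝ} (hq0 : q ≠ 0) (hq : |q| < 1) (e j k : ℕ) :
    Tendsto (partialSum q (e + 1) j k) atTop
      (𝓝 (q ^ (j + k) * (qPoch q j / qPoch q (e + 1 + k)) * limitSum q (e + 1) j k)) := by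
  have h0 := one_sub_pow_ne_zero hq (e + k)
  have h1 := qPoch_ne_zero hq e
  have h2 := qPoch_ne_zero hq j
  have h3 := qPoch_ne_zero hq k
  have h4 := qPoch_ne_zero hq (e + k)
  have hB := (tendsto_boundaryTerm hq e j k).div_const (1 - q ^ (e + k + 1))
  have hP : qPoch q (e + 1 + k) = qPoch q (e + k) * (1 - q ^ (e + k + 1)) := by
    rw [← qPoch_succ]; congr 1; ring
  induction j generalizing k with
  | zero =>
    have key : ∀ n, partialSum q (e + 1) 0 k n =
        boundaryTerm q (e + 1) 0 k n / (1 - q ^ (e + k + 1)) := fun n => by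
      rw [← partialSum_zero_left hq, show e + 1 + k = e + k + 1 by ring]
      field_simp
    rw [limitSum_zero_left hq, hP]
    convert! hB using 2
    · exact key _
    · rw [qPoch_zero]
      field_simp
  | succ j ih =>
    rcases k with _ | k
    · have key : ∀ n, partialSum q (e + 1) (j + 1) 0 n =
          boundaryTerm q (e + 1) (j + 1) 0 n / (1 - q ^ (e + 0 + 1)) := fun n => by
        rw [← partialSum_zero_right hq, add_zero] at *
        field_simp
      rw [limitSum_zero_right hq, hP]
      convert! hB using 2
      · exact key _
      · simp only [qPoch_zero, add_zero] at h0 h4 ⊢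
        field_simp
    · have i1 := one_sub_pow_ne_zero hq (e + k)
      have i2 := qPoch_ne_zero hq (e + k)
      have i3 := qPoch_ne_zero hq j
      have i4 := qPoch_ne_zero hq k
      have i5 : qPoch q (e + 1 + k) = qPoch q (e + k) * (1 - q ^ (e + k + 1)) := by
        rw [← qPoch_succ]; congr 1; ring
      have hI := ih k i1 i3 i4 i2
        ((tendsto_boundaryTerm hq e j k).div_const (1 - q ^ (e + k + 1))) i5
      have hL := ((hI.const_mul (q * (1 - q ^ (j + 1)))).div_const
        (1 - q ^ (e + (k + 1) + 1))).add hB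
      have key : ∀ n, partialSum q (e + 1) (j + 1) (k + 1) n =
          q * (1 - q ^ (j + 1)) * partialSum q (e + 1) j k n / (1 - q ^ (e + (k + 1) + 1)) +
          boundaryTerm q (e + 1) (j + 1) (k + 1) n / (1 - q ^ (e + (k + 1) + 1)) := fun n => by
        rw [← add_div, ← partialSum_succ_succ hq0 hq,
          show e + 1 + (k + 1) = e + (k + 1) + 1 by ring]
        field_simp
      convert! hL using 2
      · exact key _
      · have i6 := one_sub_pow_ne_zero hq j
        rw [limitSum_succ_succ hq0 hq, hP, i5, show e + (k + 1) = e + k + 1 from rfl,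
          qPoch_succ q (e + k), qPoch_succ q j]
        replace h0 : 1 - q ^ (e + k + 1 + 1) ≠ 0 := h0
        generalize limitSum q (e + 1) j k = s
        generalize 1 - q ^ (e + k + 1 + 1) = a at h0 ⊢
        generalize 1 - q ^ (e + k + 1) = b at i1 ⊢
        field_simp
        ring

/-! ### Asymptotics as N tends to infinity -/

/-- Passing from d to d+1 multiplies the product by the telescoped factor (q;q)_d / (q;q)_{d+n},
which tends to (q;q)_d / (q;q)_∞. -/
theorem tendsto_prod_qPoch_div {q : ℝ} (hq : |q| < 1) (d : ℕ) :
    Tendsto (fun n => ∏ b ∈ Finset.range n, qPoch q b / qPoch q (d + b)) atTop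
      (𝓝 ((∏ i ∈ Finset.range d, qPoch q i) / qPochInf q ^ d)) := by
  induction d with
  | zero =>
    have : ∀ n, ∏ b ∈ Finset.range n, qPoch q b / qPoch q (0 + b) = 1 := fun n =>
      Finset.prod_eq_one fun b _ => by rw [zero_add, div_self (qPoch_ne_zero hq b)]
    simp only [this, Finset.prod_range_zero, pow_zero, div_one]
    exact tendsto_const_nhds
  | succ d ih =>
    have h1 : Tendsto (fun n => qPoch q d / qPoch q (d + n)) atTop
        (𝓝 (qPoch q d / qPochInf q)) := by
      refine tendsto_const_nhds.div ?_ (qPochInf_ne_zero hq)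
      simp only [add_comm d]
      exact (tendsto_add_atTop_iff_nat d).2 (tendsto_qPoch hq)
    have h2 := ih.mul h1
    rw [Finset.prod_range_succ, pow_succ, mul_div_mul_comm]
    refine h2.congr fun n => ?_
    induction n with
    | zero => simp [div_self (qPoch_ne_zero hq d)]
    | succ n ihn =>
      rw [Finset.prod_range_succ, Finset.prod_range_succ fun b => qPoch q b / qPoch q (d + 1 + b),
        ← ihn]
      have i1 := qPoch_ne_zero hq (d + n)
      have i2 := qPoch_ne_zero hq (d + (n + 1))
      rw [show d + 1 + n = d + (n + 1) by ring]
      field_simp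

theorem tendsto_skewSchur_div {q : ℝ} (hq0 : q ≠ 0) (hq : |q| < 1) {d : ℕ} (hd : 1 ≤ d)
    (j k : ℕ) :
    Tendsto
      (fun N : ℕ => skewSchur (rectAddRow d N j) (oneRow k) (fun i => q ^ i) /
        (q ^ ((d : ℤ) * j - (d - 1) * k + (d : ℤ) * (d - 1) / 2 * N) *
          ((1 - q) ^ (d * (d - 1) / 2) * qBarnes q (d + 1) / qPochInf q ^ d)))
      atTop (𝓝 (limitSum q d j k)) := by
  have hp : ∏ i ∈ Finset.range d, qPoch q i ≠ 0 :=
    Finset.prod_ne_zero_iff.2 fun i _ => qPoch_ne_zero hq i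
  have h0 := one_sub_ne_zero_of_abs_lt hq
  have hinf := qPochInf_ne_zero hq
  have hj := qPoch_ne_zero hq j
  have hdk := qPoch_ne_zero hq (d + k)
  have hG : (1 - q) ^ (d * (d - 1) / 2) * qBarnes q (d + 1) = ∏ i ∈ Finset.range d, qPoch q i := by
    rw [qBarnes_succ, ← Nat.choose_two_right]
    field_simp
  obtain ⟨e, rfl⟩ := Nat.exists_eq_add_of_le' hd
  have h1 := (tendsto_add_atTop_iff_nat 1).2 (tendsto_partialSum hq0 hq e j k)
  have h2 := (tendsto_add_atTop_iff_nat 1).2 (tendsto_prod_qPoch_div hq (e + 1))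
  -- The constant normalizes the limit to `limitSum`. The power q^(j+k) is the discrepancy between
  -- the exponent (d-1)j - dk of the exact formula and dj - (d-1)k in A_N.
  have h3 := (h2.mul h1).const_mul ((qPochInf q ^ (e + 1) / ∏ i ∈ Finset.range (e + 1), qPoch q i) *
    (qPoch q (e + 1 + k) / qPoch q j) / q ^ (j + k))
  have hlim : qPochInf q ^ (e + 1) / (∏ i ∈ Finset.range (e + 1), qPoch q i) *
      (qPoch q (e + 1 + k) / qPoch q j) / q ^ (j + k) *
      ((∏ i ∈ Finset.range (e + 1), qPoch q i) / qPochInf q ^ (e + 1) *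
        (q ^ (j + k) * (qPoch q j / qPoch q (e + 1 + k)) * limitSum q (e + 1) j k)) =
      limitSum q (e + 1) j k := by
    field_simp
  rw [hlim] at h3
  refine h3.congr' ?_
  filter_upwards [eventually_ge_atTop j, eventually_ge_atTop k] with N hjN hkN
  rw [skewSchur, (hasSum_weight_rectAddRow hq0 hq hd hjN hkN).tsum_eq, hG, mul_sub_one_ediv_two,
    ← partialSum]
  have e1 : q ^ (((e + 1 : ℕ) : ℤ) * j - ((e + 1 : ℕ) - 1) * k + ((e + 1).choose 2 : ℕ) * N) =
      (q ^ (e + 1).choose 2) ^ N * ((q ^ (e + 1)) ^ j / q ^ (e * k)) := by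
    rw [show (((e + 1 : ℕ) : ℤ) - 1) = (e : ℕ) by push_cast; ring, zpow_add₀ hq0, zpow_sub₀ hq0,
      ← Nat.cast_mul, ← Nat.cast_mul, ← Nat.cast_mul]
    simp only [zpow_natCast, pow_mul]
    ring
  rw [e1]
  field_simp
  ring

theorem qPoch_pos {q : ℝ} (hq : |q| < 1) (n : ℕ) : 0 < qPoch q n := by
  refine Finset.prod_pos fun i hi => ?_
  have h : |q ^ i| < 1 := by
    rw [abs_pow]
    exact pow_lt_one₀ (abs_nonneg q) hq (by have := (Finset.mem_Icc.1 hi).1; omega)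
  linarith [(abs_lt.1 h).2]

/-- For positive q every summand is positive, so the limit is nonzero and convergence of the
quotient can be upgraded to asymptotic equivalence. -/
theorem limitSum_pos {q : ℝ} (hq0 : 0 < q) (hq : |q| < 1) {d : ℕ} (hd : 1 ≤ d) (j k : ℕ) :
    0 < limitSum q d j k := by
  refine Finset.sum_pos (fun r hr => ?_) ⟨0, by simp⟩
  have hr := Finset.mem_range.1 hr
  rw [show d + k - r - 1 = d - 1 + (k - r) by omega, qBinom_add hq]
  have h1 := qPoch_pos hq (j - r)
  have h2 := qPoch_pos hq (d - 1 + (k - r))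
  have h3 := qPoch_pos hq (k - r)
  have h4 := qPoch_pos hq (d - 1)
  positivity

end

theorem mainTheorem9 (q : ℝ) (hq0 : q ≠ 0) (hq1 : |q| < 1) (d j k : ℕ) (hd : 1 ≤ d) :
    (∀ N : ℕ, j ≤ N → k ≤ N →
      Summable (fun T : SkewTableau (rectAddRow d N j) (oneRow k) => T.weight (fun i => q ^ i)) ∧
      skewSchur (rectAddRow d N j) (oneRow k) (fun i => q ^ i) =
        q ^ (((d : ℤ) - 1) * j - d * k + (d : ℤ) * (d - 1) / 2 * N) / (1 - q) ^ (d * (N + 1)) *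
          (qBarnes q (N + 2) * qBarnes q (d + 1) / qBarnes q (d + N + 2)) *
          (qPoch q (d + k) / qPoch q j) *
          ∑ r ∈ Finset.Icc (max j k) N,
            q ^ r * qBinom q r (r - k) * qBinom q (d + r - j - 1) (r - j)) ∧
    Tendsto
      (fun N : ℕ => skewSchur (rectAddRow d N j) (oneRow k) (fun i => q ^ i) /
        (q ^ ((d : ℤ) * j - (d - 1) * k + (d : ℤ) * (d - 1) / 2 * N) *
          ((1 - q) ^ (d * (d - 1) / 2) * qBarnes q (d + 1) / qPochInf q ^ d)))
      atTop
      (𝓝 (∑ r ∈ Finset.range (min j k + 1),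
        (q ^ r)⁻¹ * (1 / qPoch q (j - r)) * qBinom q (d + k - r - 1) (k - r))) ∧
    (0 < q →
      (fun N : ℕ => skewSchur (rectAddRow d N j) (oneRow k) (fun i => q ^ i)) ~[atTop]
      (fun N : ℕ =>
        q ^ ((d : ℤ) * j - (d - 1) * k + (d : ℤ) * (d - 1) / 2 * N) *
          ((1 - q) ^ (d * (d - 1) / 2) * qBarnes q (d + 1) / qPochInf q ^ d) *
          ∑ r ∈ Finset.range (min j k + 1),
            (q ^ r)⁻¹ * (1 / qPoch q (j - r)) * qBinom q (d + k - r - 1) (k - r))) := by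
  have hlim := tendsto_skewSchur_div hq0 hq1 hd j k
  refine ⟨fun N hj hk => ?_, hlim, fun hq => ?_⟩
  · have h := hasSum_weight_rectAddRow' hq0 hq1 hd hj hk
    exact ⟨h.summable, h.tsum_eq⟩
  · have hS := limitSum_pos hq hq1 hd j k
    refine isEquivalent_of_tendsto_one ?_
    have h := hlim.div_const (limitSum q d j k)
    rw [div_self hS.ne'] at h
    refine h.congr fun N => ?_
    rw [div_div]
    rfl
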